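/- Let $d\ge 1$ and let $\alpha_1,\dots,\alpha_d$ be irrational numbers which are not simultaneously diophantine; that is, there are no $\nu>0$ and $C>0$ such that $\max(\|q\alpha_1\|,\dots,\|q\alpha_d\|)>C/q^{1+\nu}$ for every integer $q\ge 1$, where $\|x\|$ denotes the distance from $x$ to $\mathbb Z$. Then there exists a complete $C^1$ vector field $\xi\,\partial_x$ on $\mathbb R_+=[0,+\infty)$ which is contracting, i.e. $\xi(0)=0$ and $\xi(x)<0$ for every $x>0$, with the following properties, where $f^t$ denotes its time-$t$ map: (1) $f^t$ is $C^\infty$ on $\mathbb R_+$ for every $t\in\mathbb Z+\alpha_1\mathbb Z+\dots+\alpha_d\mathbb Z$; (2) there is a Cantor set $H\subset\mathbb R$ (a subset homeomorphic to $\{0,1\}^{\mathbb N}$) such that $f^t$ is not $C^2$ on $\mathbb R_+$ for any $t\in H$; (3) in particular, $\xi$ is not $C^2$ on $\mathbb R_+$. -/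

import Mathlib

open Set
open scoped ContDiff

/-- The distance from a real number to `ℤ` (`round x` is a nearest integer to `x`). -/
noncomputable def distInt (x : ℝ) : ℝ := |x - round x|

/-- The numbers `α₁, …, α_d` are simultaneously diophantine: for some `ν > 0` and `C > 0`,
`max (‖q α₁‖, …, ‖q α_d‖) > C / q ^ (1 + ν)` for every positive integer `q`, where `‖·‖` is the
distance to `ℤ`. (The supremum over the finite set `Fin d` is the maximum when `d ≥ 1`.) -/
def SimultaneouslyDiophantine {d : ℕ} (α : Fin d → ℝ) : Prop :=
  ∃ ν : ℝ, 0 < ν ∧ ∃ C : ℝ, 0 < C ∧ ∀ q : ℕ, 0 < q →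
    C / (q : ℝ) ^ (1 + ν) < ⨆ i, distInt ((q : ℝ) * α i)

/-- The vector field `ξ ∂ₓ` on `ℝ₊ = [0, ∞)` is contracting: it vanishes at `0` only and points
leftwards everywhere else. Only the values of `ξ` on `[0, ∞)` matter. -/
def IsContracting (ξ : ℝ → ℝ) : Prop :=
  ξ 0 = 0 ∧ ∀ x : ℝ, 0 < x → ξ x < 0

/-- `f` is the (globally defined) flow on `ℝ₊ = [0, ∞)` of the vector field `ξ ∂ₓ` on `ℝ₊`: for
every `x ≥ 0`, the curve `t ↦ f t x`, `t ∈ ℝ`, starts at `x`, stays in `ℝ₊` and is an integral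
curve of `ξ`. Such an `f` exists exactly when `ξ` is complete; for `ξ` of class `C¹` on `ℝ₊`, it
is unique on `ℝ₊`, and `f t` is then the time-`t` map of `ξ`. -/
def IsCompleteFlow (ξ : ℝ → ℝ) (f : ℝ → ℝ → ℝ) : Prop :=
  ∀ x : ℝ, 0 ≤ x →
    f 0 x = x ∧ (∀ t : ℝ, 0 ≤ f t x) ∧ IsIntegralCurve (fun t => f t x) (fun _ => ξ)

/-- `H` is a Cantor set: it is homeomorphic to the Cantor space `{0, 1}^ℕ`. -/
def IsCantorSet (H : Set ℝ) : Prop :=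
  Nonempty (H ≃ₜ (ℕ → Bool))

/-!
The field `ξ` is built from a base field by a small oscillating change of time.

Because the `α i` are irrational and not simultaneously diophantine, there are integers
`q 0 < q 1 < …`, growing as fast as desired, such that every `q m * α i` is within
`q m ^ (-(2 m + 8) ^ 2)` of an integer (`exists_frequencies`). Put `z m = log (q m)`. The base field
is `-exp (-E x)`, where `E x` is `1 / x` except on the slow regions `z m * x ∈ [4, 5]`, where it is
raised to a constant for which the speed equals `q m ^ (-(2 m + 6))`. As `z m` is comparable to
`1 / x` there, all derivatives of `E` are polynomially bounded in `1 / x`, and every time-`s` map of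
the base field is smooth (`Frequencies.contDiff_baseMap`).

Let `φ` be an integral curve of the base field. The perturbed field has the integral curve
`t ↦ φ (t + w t)` (`Frequencies.orbit`), where, while `φ t` crosses the `m`-th region, the wobble is
`w t = q m ^ (-(m + 3)) * sin (2π q m t)`, cut off outside a larger region. All derivatives of `w`
tend to `0`, which makes the perturbed field `C¹` (`Frequencies.contDiff_one_field`).

The time-`s` map of the perturbed field is that of the base field preceded by a displacement along
the base flow, of duration `w (t + s) - w t`. This map is smooth at the origin if the displacement,
with all its derivatives, is negligible with respect to every power of the speed. Away from the slow
regions, the speed is at least `q m ^ (-2)` and the smallness of `w` suffices. In a slow region the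
speed is much smaller than `w`, but `w` is exactly periodic of period `1 / q m`, and
`w (t + s) - w t` is tiny when `q m * s` is close enough to an integer, which is so for
`s ∈ ℤ + ∑ ℤ α i` (`Frequencies.tendsto_pow_mul_iteratedDeriv_drift`, `Frequencies.contDiff_flow`).

Conversely, in a slow region the base flow is a translation of speed `κ = q m ^ (-(2 m + 6))`, the
square of the amplitude of `w`, and the crossing takes so long that a full period of `w` is seen
around an integer time. When `q m * s` is not too close to an integer, the derivative of the
time-`s` map varies by at least about `q m ^ (-(m + 4))` on an interval of length at most `κ / q m`,
so that it is not Lipschitz near the origin (`Frequencies.not_contDiffOn_flow`); the same comparison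
applies to the derivative of the field (`Frequencies.not_contDiffOn_field`). The times `s ∈ [0, 1]`
for which `q m * s` stays at distance at least `1 / (2 q m)` from the integers for all `m` form a
closed set of positive measure, which therefore contains a Cantor set
(`Frequencies.exists_isCantorSet_nonResonant`).
-/

open Filter Topology

/-! ### Gluing at the origin and Lipschitz bounds -/

/-- A function that vanishes on `(-∞, 0]` and whose first `n` derivatives on `(0, ∞)` tend to `0`
at `0` is of class `C^n` on the line. -/
theorem contDiff_nat_of_flat {n : ℕ} {r : ℝ → ℝ} (h0 : ∀ x ≤ 0, r x = 0)
    (hr : ContDiffOn ℝ n r (Ioi 0))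
    (hflat : ∀ k ≤ n, Tendsto (iteratedDeriv k r) (𝓝[>] 0) (𝓝 0)) : ContDiff ℝ n r := by
  have hcont0 : ∀ r : ℝ → ℝ, (∀ x ≤ 0, r x = 0) → Tendsto r (𝓝[>] 0) (𝓝 0) →
      ContinuousAt r 0 := by
    intro r h0 h
    rw [continuousAt_iff_continuous_left'_right']
    refine ⟨?_, ?_⟩
    · have : Tendsto r (𝓝[<] 0) (𝓝 0) := by
        refine tendsto_const_nhds.congr' ?_
        filter_upwards [self_mem_nhdsWithin] with x hx
        exact (h0 x (le_of_lt hx)).symm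
      simpa [ContinuousWithinAt, h0 0 le_rfl] using this
    · simpa [ContinuousWithinAt, h0 0 le_rfl] using h
  induction n generalizing r with
  | zero =>
    rw [Nat.cast_zero, contDiff_zero, continuous_iff_continuousAt]
    intro x
    rcases lt_trichotomy x 0 with hx | rfl | hx
    · have : r =ᶠ[𝓝 x] fun _ => 0 := by
        filter_upwards [Iio_mem_nhds hx] with y hy using h0 y (le_of_lt hy)
      exact this.continuousAt
    · exact hcont0 r h0 (by simpa using hflat 0 le_rfl)
    · exact (hr.continuousOn).continuousAt (Ioi_mem_nhds hx)
  | succ n ih =>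
    have hneg : ∀ x < 0, HasDerivAt r 0 x := by
      intro x hx
      have : r =ᶠ[𝓝 x] fun _ => 0 := by
        filter_upwards [Iio_mem_nhds hx] with y hy using h0 y (le_of_lt hy)
      exact (hasDerivAt_const x (0 : ℝ)).congr_of_eventuallyEq this
    have hpos : ∀ x > 0, DifferentiableAt ℝ r x := fun x hx =>
      (hr.differentiableOn (by simp)).differentiableAt (Ioi_mem_nhds hx)
    set g : ℝ → ℝ := fun x => if x ≤ 0 then 0 else deriv r x with hg
    have hgflat : Tendsto g (𝓝[>] 0) (𝓝 0) := by
      have := hflat 1 (by omega)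
      rw [iteratedDeriv_one] at this
      refine this.congr' ?_
      filter_upwards [self_mem_nhdsWithin] with x hx
      simp [hg, not_le.2 (show (0 : ℝ) < x from hx)]
    have hrflat : Tendsto r (𝓝[>] 0) (𝓝 0) := by simpa using hflat 0 (by omega)
    have hd : ∀ x, HasDerivAt r (g x) x := by
      refine hasDerivAt_of_hasDerivAt_of_ne' (x := 0) ?_ (hcont0 r h0 hrflat)
        (hcont0 g (fun x hx => by simp [hg, hx]) hgflat)
      intro y hy
      rcases lt_or_gt_of_ne hy with h | h
      · simpa [hg, h.le] using hneg y h
      · simpa [hg, not_le.2 h] using (hpos y h).hasDerivAt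
    have hderiv : deriv r = g := funext fun x => (hd x).deriv
    rw [Nat.cast_add, Nat.cast_one, contDiff_succ_iff_deriv]
    refine ⟨fun x => (hd x).differentiableAt, fun h => by simp at h, ?_⟩
    refine ih (fun x hx => by rw [hderiv]; exact if_pos hx) ?_ ?_
    · exact ((contDiffOn_succ_iff_deriv_of_isOpen isOpen_Ioi).1 (by exact_mod_cast hr)).2.2
    · intro k hk
      have := hflat (k + 1) (by omega)
      rwa [iteratedDeriv_succ'] at this

theorem contDiff_infty_of_flat {r : ℝ → ℝ} (h0 : ∀ x ≤ 0, r x = 0)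
    (hr : ContDiffOn ℝ ∞ r (Ioi 0))
    (hflat : ∀ k, Tendsto (iteratedDeriv k r) (𝓝[>] 0) (𝓝 0)) : ContDiff ℝ ∞ r :=
  contDiff_infty.2 fun n => contDiff_nat_of_flat h0 (hr.of_le (by exact_mod_cast le_top))
    fun k _ => hflat k

/-- The derivative of a function of class `C²` on `[0, ∞)` is Lipschitz near the boundary point. -/
theorem exists_lipschitz_deriv_of_contDiffOn_two {F : ℝ → ℝ} (hF : ContDiffOn ℝ 2 F (Ici 0)) :
    ∃ K : ℝ, 0 ≤ K ∧ ∀ x ∈ Ioc (0 : ℝ) 1, ∀ y ∈ Ioc (0 : ℝ) 1,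
      |deriv F x - deriv F y| ≤ K * |x - y| := by
  have hU : UniqueDiffOn ℝ (Ici (0 : ℝ)) := uniqueDiffOn_Ici 0
  have h1 : ContDiffOn ℝ 1 (derivWithin F (Ici 0)) (Ici 0) :=
    hF.derivWithin hU (by norm_num)
  have h2 : ContinuousOn (derivWithin (derivWithin F (Ici 0)) (Ici 0)) (Ici 0) :=
    h1.continuousOn_derivWithin hU le_rfl
  obtain ⟨K, hK⟩ := isCompact_Icc.exists_bound_of_continuousOn
    (h2.mono fun z (hz : z ∈ Icc (0 : ℝ) 1) => hz.1)
  have hK0 : 0 ≤ K := (norm_nonneg _).trans (hK 0 (by simp))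
  refine ⟨K, hK0, fun x hx y hy => ?_⟩
  have hd : ∀ z : ℝ, 0 < z → derivWithin F (Ici 0) z = deriv F z := fun z hz =>
    derivWithin_of_mem_nhds (Ici_mem_nhds hz)
  have key : ∀ z ∈ Icc (0 : ℝ) 1, HasDerivWithinAt (derivWithin F (Ici 0))
      (derivWithin (derivWithin F (Ici 0)) (Ici 0) z) (Icc 0 1) z := fun z hz =>
    ((h1.differentiableOn one_ne_zero z hz.1).hasDerivWithinAt).mono Icc_subset_Ici_self
  have := (convex_Icc (0 : ℝ) 1).norm_image_sub_le_of_norm_hasDerivWithin_le key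
    (fun z hz => hK z hz) (Ioc_subset_Icc_self hy) (Ioc_subset_Icc_self hx)
  rw [hd x hx.1, hd y hy.1] at this
  simpa using this

/-! ### Derivatives along a change of variable -/

/-- The derivation `F ↦ g F'`. If `τ' = g ∘ τ`, then differentiating `F ∘ τ` amounts to applying
this operator to `F`. -/
noncomputable def fieldDeriv (g F : ℝ → ℝ) : ℝ → ℝ := fun t => g t * deriv F t

theorem ContDiffAt.deriv_infty {F : ℝ → ℝ} {t : ℝ} (hF : ContDiffAt ℝ ∞ F t) :
    ContDiffAt ℝ ∞ (deriv F) t := by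
  have h := hF.fderiv_right (m := ∞) (by exact_mod_cast le_rfl)
  have : deriv F = fun x => fderiv ℝ F x 1 := by ext x; simp
  rw [this]
  exact h.clm_apply contDiffAt_const

theorem ContDiffAt.fieldDeriv {g F : ℝ → ℝ} {t : ℝ} (hg : ContDiffAt ℝ ∞ g t)
    (hF : ContDiffAt ℝ ∞ F t) : ContDiffAt ℝ ∞ (fieldDeriv g F) t :=
  hg.mul hF.deriv_infty

theorem iteratedDeriv_comp_eq_iterate_fieldDeriv {g τ : ℝ → ℝ} {O : Set ℝ} (hO : IsOpen O)
    (hτ : ∀ x ∈ O, HasDerivAt τ (g (τ x)) x) (hg : ∀ x ∈ O, ContDiffAt ℝ ∞ g (τ x)) (k : ℕ) :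
    ∀ F : ℝ → ℝ, (∀ x ∈ O, ContDiffAt ℝ ∞ F (τ x)) → ∀ x ∈ O,
      iteratedDeriv k (F ∘ τ) x = ((fieldDeriv g)^[k] F) (τ x) := by
  induction k with
  | zero => intro F _ x _; simp
  | succ k ih =>
    intro F hF x hx
    rw [iteratedDeriv_succ', Function.iterate_succ_apply,
      ← ih (fieldDeriv g F) (fun y hy => (hg y hy).fieldDeriv (hF y hy)) x hx]
    apply Filter.EventuallyEq.iteratedDeriv_eq
    filter_upwards [hO.mem_nhds hx] with y hy
    have := ((hF y hy).differentiableAt (by simp)).hasDerivAt.comp y (hτ y hy)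
    rw [this.deriv]
    simp [fieldDeriv, mul_comm]

theorem abs_iteratedDeriv_mul_le {F G : ℝ → ℝ} {t : ℝ} {n : ℕ} (hF : ContDiffAt ℝ ∞ F t)
    (hG : ContDiffAt ℝ ∞ G t) {a b : ℝ} (ha : ∀ i ≤ n, |iteratedDeriv i F t| ≤ a)
    (hb : ∀ i ≤ n, |iteratedDeriv i G t| ≤ b) {i : ℕ} (hi : i ≤ n) :
    |iteratedDeriv i (fun x => F x * G x) t| ≤ 2 ^ i * (a * b) := by
  have ha0 : 0 ≤ a := (abs_nonneg _).trans (ha 0 (Nat.zero_le _))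
  rw [iteratedDeriv_fun_mul (hF.of_le (by exact_mod_cast le_top))
    (hG.of_le (by exact_mod_cast le_top))]
  refine (Finset.abs_sum_le_sum_abs _ _).trans ?_
  have h2 : (2 : ℝ) ^ i = ∑ j ∈ Finset.range (i + 1), (i.choose j : ℝ) := by
    exact_mod_cast (Nat.sum_range_choose i).symm
  rw [h2, Finset.sum_mul]
  refine Finset.sum_le_sum fun j hj => ?_
  have hj' : j ≤ i := Nat.lt_succ_iff.1 (Finset.mem_range.1 hj)
  rw [abs_mul, abs_mul, Nat.abs_cast, mul_assoc]
  gcongr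
  · exact ha j (by omega)
  · exact hb (i - j) (by omega)

/-- Weighted bound for iterates of the derivation `F ↦ g F'`: if the `i`-th derivative of `g` at `t`
has size at most `A w^(1-i)`, then `k` applications cost `A^k`, once the `j`-th derivative of `F` is
weighted by `w^j`. -/
theorem exists_abs_iterate_fieldDeriv_le (k : ℕ) : ∃ C : ℝ, 0 ≤ C ∧ ∀ (g F : ℝ → ℝ) (t A w : ℝ),
    0 ≤ A → 0 ≤ w → ContDiffAt ℝ ∞ g t → ContDiffAt ℝ ∞ F t →
    (∀ i ≤ k, |iteratedDeriv i g t| * w ^ i ≤ A * w) →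
    |((fieldDeriv g)^[k] F) t| ≤ C * A ^ k * ∑ j ∈ Finset.range (k + 1),
      w ^ j * |iteratedDeriv j F t| := by
  induction k with
  | zero => exact ⟨1, zero_le_one, fun g F t A w _ _ _ _ _ => by simp⟩
  | succ k ih =>
    obtain ⟨C, hC0, hC⟩ := ih
    refine ⟨C * ((k + 1) * 2 ^ k), by positivity, fun g F t A w hA hw hg hF hbd => ?_⟩
    rw [Function.iterate_succ_apply]
    refine (hC g (fieldDeriv g F) t A w hA hw hg (hg.fieldDeriv hF)
      fun i hi => hbd i (by omega)).trans ?_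
    set S := ∑ j ∈ Finset.range (k + 1 + 1), w ^ j * |iteratedDeriv j F t| with hS
    have hterm : ∀ j ≤ k + 1, w ^ j * |iteratedDeriv j F t| ≤ S := fun j hj =>
      Finset.single_le_sum (f := fun j => w ^ j * |iteratedDeriv j F t|)
        (fun _ _ => by positivity) (Finset.mem_range.2 (by omega))
    have hS0 : 0 ≤ S := Finset.sum_nonneg fun _ _ => by positivity
    have hj : ∀ j ∈ Finset.range (k + 1),
        w ^ j * |iteratedDeriv j (fieldDeriv g F) t| ≤ 2 ^ k * (A * S) := by
      intro j hj
      have hjk : j ≤ k := Nat.lt_succ_iff.1 (Finset.mem_range.1 hj)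
      have : iteratedDeriv j (fieldDeriv g F) t = ∑ i ∈ Finset.range (j + 1),
          j.choose i * iteratedDeriv i g t * iteratedDeriv (j - i) (deriv F) t :=
        iteratedDeriv_fun_mul (hg.of_le (by exact_mod_cast le_top))
          (hF.deriv_infty.of_le (by exact_mod_cast le_top))
      rw [this]
      calc w ^ j * |∑ i ∈ Finset.range (j + 1),
            j.choose i * iteratedDeriv i g t * iteratedDeriv (j - i) (deriv F) t|
          ≤ w ^ j * ∑ i ∈ Finset.range (j + 1),
            |j.choose i * iteratedDeriv i g t * iteratedDeriv (j - i) (deriv F) t| := by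
            gcongr; exact Finset.abs_sum_le_sum_abs _ _
        _ = ∑ i ∈ Finset.range (j + 1), w ^ j *
            |j.choose i * iteratedDeriv i g t * iteratedDeriv (j - i) (deriv F) t| :=
            Finset.mul_sum _ _ _
        _ ≤ ∑ i ∈ Finset.range (j + 1), (j.choose i : ℝ) * (A * S) := by
            refine Finset.sum_le_sum fun i hi => ?_
            have hij : i ≤ j := Nat.lt_succ_iff.1 (Finset.mem_range.1 hi)
            rw [← iteratedDeriv_succ', abs_mul, abs_mul, Nat.abs_cast]
            have e : w ^ j = w ^ i * w ^ (j - i) := by rw [← pow_add]; congr 1; omega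
            calc w ^ j * ((j.choose i : ℝ) * |iteratedDeriv i g t|
                  * |iteratedDeriv (j - i + 1) F t|)
                = (j.choose i : ℝ) * ((|iteratedDeriv i g t| * w ^ i) *
                  (w ^ (j - i) * |iteratedDeriv (j - i + 1) F t|)) := by rw [e]; ring
              _ ≤ (j.choose i : ℝ) * ((A * w) *
                  (w ^ (j - i) * |iteratedDeriv (j - i + 1) F t|)) := by
                  exact mul_le_mul_of_nonneg_left (mul_le_mul_of_nonneg_right
                    (hbd i (by omega)) (by positivity)) (by positivity)
              _ = (j.choose i : ℝ) * (A *
                  (w ^ (j - i + 1) * |iteratedDeriv (j - i + 1) F t|)) := by ring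
              _ ≤ (j.choose i : ℝ) * (A * S) := by
                  gcongr; exact hterm _ (by omega)
        _ = 2 ^ j * (A * S) := by
            rw [← Finset.sum_mul]; congr 1; exact_mod_cast Nat.sum_range_choose j
        _ ≤ 2 ^ k * (A * S) := by
            gcongr; norm_num
    calc C * A ^ k * ∑ j ∈ Finset.range (k + 1), w ^ j * |iteratedDeriv j (fieldDeriv g F) t|
        ≤ C * A ^ k * ∑ j ∈ Finset.range (k + 1), 2 ^ k * (A * S) := by
          exact mul_le_mul_of_nonneg_left (Finset.sum_le_sum hj) (by positivity)
      _ = C * ((k + 1) * 2 ^ k) * A ^ (k + 1) * S := by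
          simp only [Finset.sum_const, Finset.card_range, nsmul_eq_mul]; push_cast; ring

/-! ### Functions with polynomially bounded derivatives along a filter -/

/-- Along the filter `l`, the function `F` is smooth and its derivatives up to order `n` are bounded
by a power of the gauge `W` times the size `M`: `|F^(i)| ≤ C W^N M`. -/
def PolyBounded (l : Filter ℝ) (W M : ℝ → ℝ) (n : ℕ) (F : ℝ → ℝ) : Prop :=
  (∀ᶠ t in l, ContDiffAt ℝ ∞ F t) ∧
    ∃ (C : ℝ) (N : ℕ), 0 ≤ C ∧ ∀ᶠ t in l, ∀ i ≤ n, |iteratedDeriv i F t| ≤ C * W t ^ N * M t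

namespace PolyBounded

variable {l : Filter ℝ} {W M M' : ℝ → ℝ} {n : ℕ} {F G : ℝ → ℝ}

theorem mono_order {m : ℕ} (hF : PolyBounded l W M n F) (h : m ≤ n) : PolyBounded l W M m F := by
  obtain ⟨h1, C, N, hC, h2⟩ := hF
  exact ⟨h1, C, N, hC, h2.mono fun t ht i hi => ht i (hi.trans h)⟩

theorem mul (hF : PolyBounded l W M n F) (hG : PolyBounded l W M' n G) :
    PolyBounded l W (fun t => M t * M' t) n (fun t => F t * G t) := by
  obtain ⟨hF1, C, N, hC, hF2⟩ := hF
  obtain ⟨hG1, D, K, hD, hG2⟩ := hG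
  refine ⟨by filter_upwards [hF1, hG1] with t h1 h2 using h1.mul h2,
    2 ^ n * (C * D), N + K, by positivity, ?_⟩
  filter_upwards [hF1, hG1, hF2, hG2] with t h1 h2 h3 h4 i hi
  have h0 : 0 ≤ (C * W t ^ N * M t) * (D * W t ^ K * M' t) :=
    mul_nonneg ((abs_nonneg _).trans (h3 0 (Nat.zero_le _)))
      ((abs_nonneg _).trans (h4 0 (Nat.zero_le _)))
  calc |iteratedDeriv i (fun x => F x * G x) t|
      ≤ 2 ^ i * ((C * W t ^ N * M t) * (D * W t ^ K * M' t)) :=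
        abs_iteratedDeriv_mul_le h1 h2 h3 h4 hi
    _ ≤ 2 ^ n * ((C * W t ^ N * M t) * (D * W t ^ K * M' t)) := by
        gcongr; norm_num
    _ = _ := by rw [pow_add]; ring

theorem mul_one_left (hF : PolyBounded l W 1 n F) (hG : PolyBounded l W M n G) :
    PolyBounded l W M n (fun t => F t * G t) := by
  simpa using hF.mul hG

theorem add (hW : ∀ᶠ t in l, 1 ≤ W t) (hM : ∀ᶠ t in l, 0 ≤ M t)
    (hF : PolyBounded l W M n F) (hG : PolyBounded l W M n G) :
    PolyBounded l W M n (fun t => F t + G t) := by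
  obtain ⟨hF1, C, N, hC, hF2⟩ := hF
  obtain ⟨hG1, D, K, hD, hG2⟩ := hG
  refine ⟨by filter_upwards [hF1, hG1] with t h1 h2 using h1.add h2,
    C + D, N + K, by positivity, ?_⟩
  filter_upwards [hF1, hG1, hF2, hG2, hW, hM] with t h1 h2 h3 h4 hw hm i hi
  have e : iteratedDeriv i (fun x => F x + G x) t = iteratedDeriv i F t + iteratedDeriv i G t :=
    iteratedDeriv_add (h1.of_le (by exact_mod_cast le_top)) (h2.of_le (by exact_mod_cast le_top))
  rw [e]
  have w1 : W t ^ N ≤ W t ^ (N + K) := pow_le_pow_right₀ hw (by omega)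
  have w2 : W t ^ K ≤ W t ^ (N + K) := pow_le_pow_right₀ hw (by omega)
  calc |iteratedDeriv i F t + iteratedDeriv i G t|
      ≤ C * W t ^ N * M t + D * W t ^ K * M t :=
        (abs_add_le _ _).trans (add_le_add (h3 i hi) (h4 i hi))
    _ ≤ C * W t ^ (N + K) * M t + D * W t ^ (N + K) * M t := by gcongr
    _ = _ := by ring

theorem neg (hF : PolyBounded l W M n F) : PolyBounded l W M n (fun t => -F t) := by
  obtain ⟨hF1, C, N, hC, hF2⟩ := hF
  refine ⟨hF1.mono fun t h => h.neg, C, N, hC, hF2.mono fun t h i hi => ?_⟩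
  rw [iteratedDeriv_fun_neg, abs_neg]
  exact h i hi

theorem deriv (hF : PolyBounded l W M (n + 1) F) : PolyBounded l W M n (deriv F) := by
  obtain ⟨hF1, C, N, hC, hF2⟩ := hF
  refine ⟨hF1.mono fun t h => h.deriv_infty, C, N, hC, hF2.mono fun t h i hi => ?_⟩
  rw [← iteratedDeriv_succ']
  exact h (i + 1) (by omega)

theorem congr (hF : PolyBounded l W M n F) (h : ∀ᶠ t in l, F =ᶠ[𝓝 t] G) :
    PolyBounded l W M n G := by
  obtain ⟨hF1, C, N, hC, hF2⟩ := hF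
  refine ⟨by filter_upwards [hF1, h] with t h1 h2 using h1.congr_of_eventuallyEq h2.symm,
    C, N, hC, ?_⟩
  filter_upwards [hF2, h] with t h1 h2 i hi
  rw [← h2.iteratedDeriv_eq]
  exact h1 i hi

theorem zero_of_bound (hF : ∀ᶠ t in l, ContDiffAt ℝ ∞ F t) {C : ℝ} {N : ℕ} (hC : 0 ≤ C)
    (h : ∀ᶠ t in l, |F t| ≤ C * W t ^ N * M t) : PolyBounded l W M 0 F := by
  refine ⟨hF, C, N, hC, h.mono fun t ht i hi => ?_⟩
  obtain rfl : i = 0 := by omega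
  simpa using ht

theorem succ_of_deriv (hW : ∀ᶠ t in l, 1 ≤ W t) (hM : ∀ᶠ t in l, 0 ≤ M t)
    (hF : PolyBounded l W M 0 F) (hF' : PolyBounded l W M n (_root_.deriv F)) :
    PolyBounded l W M (n + 1) F := by
  obtain ⟨hF1, C, N, hC, hF2⟩ := hF
  obtain ⟨-, D, K, hD, hG2⟩ := hF'
  refine ⟨hF1, C + D, N + K, by positivity, ?_⟩
  filter_upwards [hF2, hG2, hW, hM] with t h3 h4 hw hm i hi
  have w1 : W t ^ N ≤ W t ^ (N + K) := pow_le_pow_right₀ hw (by omega)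
  have w2 : W t ^ K ≤ W t ^ (N + K) := pow_le_pow_right₀ hw (by omega)
  have hw0 : (0 : ℝ) ≤ W t := zero_le_one.trans hw
  rcases i with _ | i
  · calc |iteratedDeriv 0 F t| ≤ C * W t ^ N * M t := h3 0 le_rfl
      _ ≤ (C + D) * W t ^ (N + K) * M t := by
        gcongr; linarith
  · rw [iteratedDeriv_succ']
    calc |iteratedDeriv i (_root_.deriv F) t| ≤ D * W t ^ K * M t := h4 i (by omega)
      _ ≤ (C + D) * W t ^ (N + K) * M t := by
        gcongr; linarith

theorem const (c : ℝ) : PolyBounded l W 1 n (fun _ => c) := by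
  refine ⟨Eventually.of_forall fun t => contDiffAt_const, |c|, 0, abs_nonneg c,
    Eventually.of_forall fun t i _ => ?_⟩
  rw [iteratedDeriv_const]
  split_ifs <;> simp

/-- Exponentials: if `F' = G F` and `G` is polynomially bounded, so is `F` relative to its own
size. -/
theorem of_deriv_eq_mul (hW : ∀ᶠ t in l, 1 ≤ W t) (hF : ∀ᶠ t in l, ContDiffAt ℝ ∞ F t)
    (hM : ∀ᶠ t in l, |F t| = M t) (hG : PolyBounded l W 1 n G)
    (h : ∀ᶠ t in l, (fun x => G x * F x) =ᶠ[𝓝 t] _root_.deriv F) : PolyBounded l W M (n + 1) F := by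
  have hM0 : ∀ᶠ t in l, 0 ≤ M t := hM.mono fun t ht => ht ▸ abs_nonneg _
  have h0 : PolyBounded l W M 0 F := zero_of_bound (N := 0) hF zero_le_one
    (hM.mono fun t ht => by simp [ht])
  suffices ∀ m ≤ n + 1, PolyBounded l W M m F from this _ le_rfl
  intro m hm
  induction m with
  | zero => exact h0
  | succ m ih =>
    refine succ_of_deriv hW hM0 h0 ?_
    exact ((hG.mono_order (by omega)).mul_one_left (ih (by omega))).congr h

/-- Reciprocals: the gauge is assumed to dominate `1 / F`. -/
theorem inv (hW : ∀ᶠ t in l, 1 ≤ W t) (hF : ∀ n, PolyBounded l W 1 n F)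
    (hne : ∀ᶠ t in l, ∀ᶠ x in 𝓝 t, F x ≠ 0) (h : ∀ᶠ t in l, |(F t)⁻¹| ≤ W t) (n : ℕ) :
    PolyBounded l W 1 n (fun t => (F t)⁻¹) := by
  have h0 : PolyBounded l W 1 0 (fun t => (F t)⁻¹) := by
    refine zero_of_bound (C := 1) (N := 1) ?_ zero_le_one (h.mono fun t ht => by simpa using ht)
    filter_upwards [(hF 0).1, hne] with t h1 h2 using h1.inv h2.self_of_nhds
  induction n with
  | zero => exact h0
  | succ n ih =>
    refine succ_of_deriv hW (Eventually.of_forall fun _ => zero_le_one) h0 ?_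
    have := ((hF (n + 1)).deriv.neg).mul_one_left (ih.mul_one_left ih)
    refine this.congr ?_
    obtain ⟨C, N, hC, h1⟩ := (hF (n + 1)).2
    filter_upwards [hne, (hF 1).1] with t h2 h3
    have h3' : ∀ᶠ x in 𝓝 t, ContDiffAt ℝ 1 F x :=
      (h3.of_le (by exact_mod_cast le_top)).eventually (by simp)
    filter_upwards [h2, h3'] with x hx hx'
    rw [((hx'.differentiableAt (by simp)).hasDerivAt.fun_inv hx).deriv]
    field_simp

/-- Composition with an inner function with bounded derivatives. -/
theorem comp_of_bounded {P : ℝ → ℝ} {l' : Filter ℝ} (hl : Tendsto G l l')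
    (hG : ∀ᶠ t in l, ContDiffAt ℝ ∞ G t)
    (hG' : ∀ n, PolyBounded l 1 1 n (_root_.deriv G)) (hP : ∀ n, PolyBounded l' 1 1 n P)
    (n : ℕ) : PolyBounded l 1 1 n (fun t => P (G t)) := by
  induction n generalizing P with
  | zero =>
    obtain ⟨h1, C, N, hC, h2⟩ := hP 0
    refine zero_of_bound (C := C) (N := N) ?_ hC ?_
    · filter_upwards [hG, hl.eventually h1] with t h3 h4 using h4.comp t h3
    · filter_upwards [hl.eventually h2] with t ht
      simpa using ht 0 le_rfl
  | succ n ih =>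
    have h0 : PolyBounded l 1 1 0 (fun t => P (G t)) := by
      obtain ⟨h1, C, N, hC, h2⟩ := hP 0
      refine zero_of_bound (C := C) (N := N) ?_ hC ?_
      · filter_upwards [hG, hl.eventually h1] with t h3 h4 using h4.comp t h3
      · filter_upwards [hl.eventually h2] with t ht
        simpa using ht 0 le_rfl
    refine succ_of_deriv (Eventually.of_forall fun _ => le_rfl)
      (Eventually.of_forall fun _ => zero_le_one) h0 ?_
    have hP' : ∀ n, PolyBounded l' 1 1 n (_root_.deriv P) := fun n => (hP (n + 1)).deriv
    refine ((ih hP').mul_one_left (hG' n)).congr ?_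
    filter_upwards [hG, hl.eventually (hP 0).1] with t h3 h4
    have h3' : ∀ᶠ x in 𝓝 t, ContDiffAt ℝ 1 G x :=
      (h3.of_le (by exact_mod_cast le_top)).eventually (by simp)
    have h4' : ∀ᶠ x in 𝓝 (G t), ContDiffAt ℝ 1 P x :=
      (h4.of_le (by exact_mod_cast le_top)).eventually (by simp)
    filter_upwards [h3', h3.continuousAt.eventually h4'] with x hx hx'
    exact ((hx'.differentiableAt (by simp)).hasDerivAt.comp x
      (hx.differentiableAt (by simp)).hasDerivAt).deriv.symm

/-- A small perturbation `D` of the inner function changes a composition by a function of the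
size of `D`, derivatives included. -/
theorem comp_add_sub {P H D : ℝ → ℝ} (hP : ContDiff ℝ ∞ P) (hPb : ∀ n, PolyBounded atTop 1 1 n P)
    (hH : ContDiff ℝ ∞ H) (hHt : Tendsto H atTop atTop)
    (hH' : ∀ n, PolyBounded atTop 1 1 n (_root_.deriv H)) (hD : ContDiff ℝ ∞ D)
    (hD0 : ∀ᶠ t in atTop, |D t| ≤ 1) (hD' : ∀ n, PolyBounded atTop 1 1 n (_root_.deriv D))
    (hDM : PolyBounded atTop 1 M n D) (hM : ∀ᶠ t in atTop, 0 ≤ M t) :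
    PolyBounded atTop 1 M n (fun t => P (H t + D t) - P (H t)) := by
  have hHD : Tendsto (fun t => H t + D t) atTop atTop := by
    refine tendsto_atTop_mono' _ ?_ (tendsto_atTop_add_const_right _ (-1 : ℝ) hHt)
    filter_upwards [hD0] with t ht
    linarith [(abs_le.1 ht).1]
  have hone : ∀ᶠ t in atTop, (1 : ℝ) ≤ (1 : ℝ → ℝ) t := Eventually.of_forall fun _ => le_rfl
  have h0 : ∀ P : ℝ → ℝ, ContDiff ℝ ∞ P → (∀ n, PolyBounded atTop 1 1 n P) →
      PolyBounded atTop 1 M 0 (fun t => P (H t + D t) - P (H t)) := by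
    intro P hP hPb
    obtain ⟨-, C, N, hC, h1⟩ := hPb 1
    obtain ⟨-, C', N', hC', h1'⟩ := hDM
    obtain ⟨T, hT⟩ := eventually_atTop.1 h1
    refine zero_of_bound (C := C * C') (N := 0)
      (Eventually.of_forall fun t => by
        exact ((hP.comp (hH.add hD)).sub (hP.comp hH)).contDiffAt) (by positivity) ?_
    filter_upwards [hHt.eventually_ge_atTop T, hHD.eventually_ge_atTop T, h1'] with t ht1 ht2 ht3
    have := (convex_Ici T).norm_image_sub_le_of_norm_deriv_le (f := P) (C := C)
      (fun x _ => (hP.differentiable (by simp)).differentiableAt)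
      (fun x hx => by simpa using hT x hx 1 le_rfl) ht1 ht2
    have h3 := ht3 0 (Nat.zero_le _)
    simp only [Real.norm_eq_abs, add_sub_cancel_left] at this
    simp only [iteratedDeriv_zero, Pi.one_apply, one_pow, mul_one] at h3 ⊢
    calc _ ≤ C * |D t| := this
      _ ≤ C * (C' * M t) := by gcongr
      _ = _ := by ring
  induction n generalizing P with
  | zero => exact h0 P hP hPb
  | succ n ih =>
    refine succ_of_deriv hone hM (h0 P hP hPb) ?_
    have hP' : ContDiff ℝ ∞ (_root_.deriv P) := by
      rw [contDiff_infty_iff_deriv] at hP; exact hP.2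
    have hPb' : ∀ n, PolyBounded atTop 1 1 n (_root_.deriv P) := fun n => (hPb (n + 1)).deriv
    have hHD' : ∀ n, PolyBounded atTop 1 1 n (_root_.deriv fun t => H t + D t) := fun n => by
      refine (add hone (Eventually.of_forall fun _ => zero_le_one) (hH' n) (hD' n)).congr
        (Eventually.of_forall fun t => Eventually.of_forall fun x => ?_)
      exact (deriv_fun_add (hH.differentiable (by simp)).differentiableAt
        (hD.differentiable (by simp)).differentiableAt).symm
    have t1 := (hH' n).mul_one_left (ih hP' hPb' (hDM.mono_order (Nat.le_succ n)))
    have t2 := (comp_of_bounded hHD (Eventually.of_forall fun t => (hH.add hD).contDiffAt) hHD'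
      hPb' n).mul_one_left hDM.deriv
    refine (add hone hM t1 t2).congr
      (Eventually.of_forall fun t => Eventually.of_forall fun x => ?_)
    have dP : ∀ y, HasDerivAt P (_root_.deriv P y) y := fun y =>
      (hP.differentiable (by simp)).differentiableAt.hasDerivAt
    have dH : HasDerivAt H (_root_.deriv H x) x :=
      (hH.differentiable (by simp)).differentiableAt.hasDerivAt
    have dD : HasDerivAt D (_root_.deriv D x) x :=
      (hD.differentiable (by simp)).differentiableAt.hasDerivAt
    have := (((dP _).comp x (dH.add dD)).sub ((dP _).comp x dH)).deriv
    simp only [Function.comp_def] at this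
    change _ = _root_.deriv ((fun t => P (H t + D t)) - fun t => P (H t)) x
    rw [show ((fun t => P (H t + D t)) - fun t => P (H t)) =
      ((fun x ↦ P ((H + D) x)) - fun x ↦ P (H x)) from rfl, this]
    simp only [Pi.add_apply]
    ring

end PolyBounded

/-! ### Inverse functions and compactly supported bumps -/

theorem exists_inverse_of_deriv_ge {T T' : ℝ → ℝ} {c : ℝ} (hc : 0 < c)
    (h : ∀ y, HasDerivAt T (T' y) y) (hT' : ∀ y, c ≤ T' y) :
    ∃ S : ℝ → ℝ, (∀ y, S (T y) = y) ∧ (∀ u, T (S u) = u) ∧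
      ∀ u, HasDerivAt S (T' (S u))⁻¹ u := by
  have hmono : StrictMono T := strictMono_of_deriv_pos fun y => by
    rw [(h y).deriv]; exact hc.trans_le (hT' y)
  have hcont : Continuous T := continuous_iff_continuousAt.2 fun y => (h y).continuousAt
  have hlin : Monotone fun y => T y - c * y := by
    have hd : ∀ y, HasDerivAt (fun y => T y - c * y) (T' y - c * 1) y := fun y =>
      (h y).sub ((hasDerivAt_id y).const_mul c)
    refine monotone_of_deriv_nonneg (fun y => (hd y).differentiableAt) fun y => ?_
    rw [(hd y).deriv]; linarith [hT' y]
  have hsurj : Function.Surjective T := by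
    refine hcont.surjective ?_ ?_
    · refine tendsto_atTop_mono' _ ?_
        (tendsto_atTop_add_const_left _ (T 0) (tendsto_id.const_mul_atTop hc))
      filter_upwards [eventually_ge_atTop 0] with y hy
      have := hlin hy
      simp only [id] at this ⊢; linarith
    · refine tendsto_atBot_mono' _ ?_
        (tendsto_atBot_add_const_left _ (T 0) (tendsto_id.const_mul_atBot hc))
      filter_upwards [eventually_le_atBot 0] with y hy
      have := hlin hy
      simp only [id] at this ⊢; linarith
  let e := StrictMono.orderIsoOfSurjective T hmono hsurj
  have he : ∀ u, T (e.symm u) = u := fun u => e.apply_symm_apply u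
  refine ⟨e.symm, fun y => e.symm_apply_apply y, he, fun u => ?_⟩
  exact HasDerivAt.of_local_left_inverse e.symm.continuous.continuousAt (h _)
    (hc.trans_le (hT' _)).ne' (Eventually.of_forall he)

theorem exists_abs_iteratedDeriv_le_of_support {F : ℝ → ℝ} (hF : ContDiff ℝ ∞ F) {a b : ℝ}
    (h : ∀ y ∉ Icc a b, F y = 0) (n : ℕ) :
    ∃ C : ℝ, 0 ≤ C ∧ ∀ i ≤ n, ∀ y, |iteratedDeriv i F y| ≤ C := by
  have hone : ∀ i : ℕ, ∃ C : ℝ, 0 ≤ C ∧ ∀ y, |iteratedDeriv i F y| ≤ C := by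
    intro i
    obtain ⟨C, hC⟩ := (isCompact_Icc (a := a) (b := b)).exists_bound_of_continuousOn
      (hF.continuous_iteratedDeriv i (by exact_mod_cast le_top)).continuousOn
    refine ⟨max C 0, le_max_right _ _, fun y => ?_⟩
    by_cases hy : y ∈ Icc a b
    · exact (hC y hy).trans (le_max_left _ _)
    · have : F =ᶠ[𝓝 y] fun _ => 0 := by
        filter_upwards [isClosed_Icc.isOpen_compl.mem_nhds hy] with x hx using h x hx
      rw [this.iteratedDeriv_eq, iteratedDeriv_fun_const_zero]
      simp
  choose C hC0 hC using hone
  refine ⟨∑ i ∈ Finset.range (n + 1), C i, Finset.sum_nonneg fun i _ => hC0 i, fun i hi y => ?_⟩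
  exact (hC i y).trans (Finset.single_le_sum (fun i _ => hC0 i) (Finset.mem_range.2 (by omega)))

/-- Bump function supported in `[3, 6]` and equal to `1` on `[4, 5]`; it locates the places where
the base field is slowed down. -/
noncomputable def slowBump (y : ℝ) : ℝ :=
  Real.smoothTransition (y - 3) * Real.smoothTransition (6 - y)

/-- Bump function supported in `[1, 8]` and equal to `1` on `[2, 7]`; it locates the oscillations of
the time change. -/
noncomputable def window (y : ℝ) : ℝ :=
  Real.smoothTransition (y - 1) * Real.smoothTransition (8 - y)

theorem contDiff_slowBump : ContDiff ℝ ∞ slowBump :=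
  (Real.smoothTransition.contDiff.comp (contDiff_id.sub contDiff_const)).mul
    (Real.smoothTransition.contDiff.comp (contDiff_const.sub contDiff_id))

theorem contDiff_window : ContDiff ℝ ∞ window :=
  (Real.smoothTransition.contDiff.comp (contDiff_id.sub contDiff_const)).mul
    (Real.smoothTransition.contDiff.comp (contDiff_const.sub contDiff_id))

theorem slowBump_eq_zero {y : ℝ} (h : y ∉ Ioo (3 : ℝ) 6) : slowBump y = 0 := by
  rw [mem_Ioo, not_and_or, not_lt, not_lt] at h
  rcases h with h | h
  · simp [slowBump, Real.smoothTransition.zero_of_nonpos (sub_nonpos.2 h)]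
  · simp [slowBump, Real.smoothTransition.zero_of_nonpos (sub_nonpos.2 h)]

theorem window_eq_zero {y : ℝ} (h : y ∉ Ioo (1 : ℝ) 8) : window y = 0 := by
  rw [mem_Ioo, not_and_or, not_lt, not_lt] at h
  rcases h with h | h
  · simp [window, Real.smoothTransition.zero_of_nonpos (sub_nonpos.2 h)]
  · simp [window, Real.smoothTransition.zero_of_nonpos (sub_nonpos.2 h)]

theorem slowBump_eq_one {y : ℝ} (h : y ∈ Icc (4 : ℝ) 5) : slowBump y = 1 := by
  rw [slowBump, Real.smoothTransition.one_of_one_le (by linarith [h.1]),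
    Real.smoothTransition.one_of_one_le (by linarith [h.2]), one_mul]

theorem window_eq_one {y : ℝ} (h : y ∈ Icc (2 : ℝ) 7) : window y = 1 := by
  rw [window, Real.smoothTransition.one_of_one_le (by linarith [h.1]),
    Real.smoothTransition.one_of_one_le (by linarith [h.2]), one_mul]

theorem slowBump_nonneg (y : ℝ) : 0 ≤ slowBump y :=
  mul_nonneg (Real.smoothTransition.nonneg _) (Real.smoothTransition.nonneg _)

theorem slowBump_le_one (y : ℝ) : slowBump y ≤ 1 :=
  mul_le_one₀ (Real.smoothTransition.le_one _) (Real.smoothTransition.nonneg _)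
    (Real.smoothTransition.le_one _)

theorem window_nonneg (y : ℝ) : 0 ≤ window y :=
  mul_nonneg (Real.smoothTransition.nonneg _) (Real.smoothTransition.nonneg _)

theorem window_le_one (y : ℝ) : window y ≤ 1 :=
  mul_le_one₀ (Real.smoothTransition.le_one _) (Real.smoothTransition.nonneg _)
    (Real.smoothTransition.le_one _)

/-! ### The base field -/

/-- A rapidly growing sequence of frequencies `q m`. The condition `q m ^ 16 ≤ q (m + 1)` separates
the scales `1 / log (q m)` at which the successive frequencies act on the space variable; the bound
on the slope of `window` keeps the derivative of the time change close to `1`, with `7` standing for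
an upper bound of `2π`. -/
structure Frequencies where
  /-- the frequencies -/
  q : ℕ → ℕ
  exp_le : ∀ m : ℕ, Real.exp (m + 10) ≤ q m
  pow_le : ∀ m, q m ^ 16 ≤ q (m + 1)
  slope_le : ∀ m y, |deriv window y| + 7 ≤ q m

namespace Frequencies

variable (Q : Frequencies)

/-- The logarithm of the `m`-th frequency; the scale of the `m`-th region is `x ≈ 1 / z m`. -/
noncomputable def z (m : ℕ) : ℝ := Real.log (Q.q m)

theorem q_pos (m : ℕ) : (0 : ℝ) < Q.q m := (Real.exp_pos _).trans_le (Q.exp_le m)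

theorem exp_z (m : ℕ) : Real.exp (Q.z m) = Q.q m := Real.exp_log (Q.q_pos m)

theorem le_z (m : ℕ) : (m : ℝ) + 10 ≤ Q.z m := (Real.le_log_iff_exp_le (Q.q_pos m)).2 (Q.exp_le m)

theorem z_pos (m : ℕ) : 0 < Q.z m :=
  lt_of_lt_of_le (by positivity) (Q.le_z m)

theorem z_le_q (m : ℕ) : Q.z m ≤ Q.q m := by
  rw [← Q.exp_z m]; linarith [Real.add_one_le_exp (Q.z m)]

theorem z_succ (m : ℕ) : 16 * Q.z m ≤ Q.z (m + 1) := by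
  have h : ((Q.q m : ℝ)) ^ 16 ≤ Q.q (m + 1) := by exact_mod_cast Q.pow_le m
  have := Real.log_le_log (pow_pos (Q.q_pos m) 16) h
  rw [Real.log_pow] at this
  simpa [z] using this

theorem z_strictMono : StrictMono Q.z :=
  strictMono_nat_of_lt_succ fun m => by linarith [Q.z_succ m, Q.z_pos m]

/-- Only the `m`-th region is active at the points comparable to `x`. -/
def Isolates (m : ℕ) (x : ℝ) : Prop :=
  ∀ y ∈ Icc (2 * x / 3) (4 * x / 3), ∀ m' ≠ m, Q.z m' * y ∉ Ioo (1 : ℝ) 8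

/-- The relevant index is the first one whose scale has been reached: smaller indices have not come
into play at `x`, and by the growth of `z` larger ones are already over. -/
theorem exists_isolates {x : ℝ} (hx : 0 < x) : ∃ m, 3 / 4 ≤ Q.z m * x ∧ Q.Isolates m x := by
  have hex : ∃ m, 3 / 4 ≤ Q.z m * x := by
    obtain ⟨m, hm⟩ := exists_nat_ge (1 / x)
    refine ⟨m, ?_⟩
    have h1 := Q.le_z m
    rw [div_le_iff₀ hx] at hm
    nlinarith
  classical
  refine ⟨Nat.find hex, Nat.find_spec hex, fun y hy m' hm' hmem => ?_⟩
  rcases lt_or_gt_of_ne hm' with h | h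
  · have h1 := not_le.1 (Nat.find_min hex h)
    have h2 := mul_le_mul_of_nonneg_left hy.2 (Q.z_pos m').le
    have := hmem.1
    nlinarith
  · have h1 := Nat.find_spec hex
    have h2 := Q.z_strictMono.monotone (Nat.succ_le_of_lt h)
    have h3 := Q.z_succ (Nat.find hex)
    have h4 := mul_le_mul_of_nonneg_left hy.1 (Q.z_pos m').le
    have h5 := mul_le_mul_of_nonneg_right (h3.trans h2) hx.le
    have := hmem.2
    nlinarith

theorem Isolates.self_mem {x : ℝ} (hx : 0 < x) : x ∈ Icc (2 * x / 3) (4 * x / 3) :=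
  ⟨by linarith, by linarith⟩

/-- The value of the exponent on the slow part of the `m`-th region. It makes the speed there equal
to `q m ^ (-(2 * m + 6))`, the square of the amplitude of the `m`-th oscillation. -/
noncomputable def level (m : ℕ) : ℝ := (2 * m + 6) * Q.z m

/-- The exponent `E` of the base field `-exp (-E)`: it equals `1 / x`, except that it is raised to
the constant `level m` where `z m * x ∈ [4, 5]`. -/
noncomputable def expo (x : ℝ) : ℝ := x⁻¹ + ∑' m, (Q.level m - x⁻¹) * slowBump (Q.z m * x)

theorem expo_eq {m : ℕ} {x y : ℝ} (h : Q.Isolates m x) (hy : y ∈ Icc (2 * x / 3) (4 * x / 3)) :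
    Q.expo y = y⁻¹ + (Q.level m - y⁻¹) * slowBump (Q.z m * y) := by
  rw [expo, tsum_eq_single m fun m' hm' => ?_]
  rw [slowBump_eq_zero fun hmem => h y hy m' hm' ⟨by linarith [hmem.1], by linarith [hmem.2]⟩,
    mul_zero]

theorem Isolates.eventually_mem {x : ℝ} (hx : 0 < x) :
    ∀ᶠ y in 𝓝 x, y ∈ Icc (2 * x / 3) (4 * x / 3) :=
  Icc_mem_nhds (by linarith) (by linarith)

theorem contDiffAt_expo {x : ℝ} (hx : 0 < x) : ContDiffAt ℝ ∞ Q.expo x := by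
  obtain ⟨m, -, hm⟩ := Q.exists_isolates hx
  have h1 : ContDiffAt ℝ ∞ (fun y : ℝ => y⁻¹) x := contDiffAt_inv ℝ hx.ne'
  have h2 : ContDiffAt ℝ ∞ (fun y : ℝ => slowBump (Q.z m * y)) x :=
    (contDiff_slowBump.comp (contDiff_const.mul contDiff_id)).contDiffAt
  have h3 : ContDiffAt ℝ ∞ (fun y : ℝ => Q.level m - y⁻¹) x := contDiffAt_const.sub h1
  refine (h1.add (h3.mul h2)).congr_of_eventuallyEq ?_
  filter_upwards [Isolates.eventually_mem hx] with y hy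
  exact Q.expo_eq hm hy

theorem level_le (m : ℕ) : Q.level m ≤ 3 * Q.z m ^ 2 := by
  have := Q.le_z m
  have h2 := Q.z_pos m
  unfold level; nlinarith

theorem level_ge (m : ℕ) : 6 * Q.z m ≤ Q.level m := by
  have h2 := Q.z_pos m
  have : (0 : ℝ) ≤ m := Nat.cast_nonneg m
  unfold level; nlinarith

theorem inv_le_expo {x : ℝ} (hx : 0 < x) : x⁻¹ ≤ Q.expo x := by
  obtain ⟨m, -, hm⟩ := Q.exists_isolates hx
  rw [Q.expo_eq hm (Isolates.self_mem hx)]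
  by_cases h : Q.z m * x ∈ Ioo (3 : ℝ) 6
  · have h1 : x⁻¹ ≤ Q.level m := by
      rw [inv_le_iff_one_le_mul₀ hx]
      have := mul_le_mul_of_nonneg_right (Q.level_ge m) hx.le
      nlinarith [h.1]
    nlinarith [slowBump_nonneg (Q.z m * x)]
  · rw [slowBump_eq_zero h]; simp

end Frequencies

theorem eventually_one_le_inv : ∀ᶠ x : ℝ in 𝓝[>] 0, 1 ≤ x⁻¹ := by
  filter_upwards [Ioo_mem_nhdsGT (zero_lt_one' ℝ)] with x hx
  exact (one_le_inv₀ hx.1).2 hx.2.le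

/-- The reciprocal itself, with the reciprocal as gauge; the case of the exponent away from the slow
regions. -/
theorem polyBounded_inv (n : ℕ) :
    PolyBounded (𝓝[>] 0) (fun x => x⁻¹) 1 n (fun x : ℝ => x⁻¹) := by
  refine PolyBounded.inv (F := fun x => x) eventually_one_le_inv ?_ ?_ ?_ n
  · have h0 : PolyBounded (𝓝[>] 0) (fun x => x⁻¹) 1 0 (fun x : ℝ => x) := by
      refine PolyBounded.zero_of_bound (C := 1) (N := 0)
        (Eventually.of_forall fun _ => contDiffAt_id) zero_le_one ?_
      filter_upwards [Ioo_mem_nhdsGT (zero_lt_one' ℝ)] with x hx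
      simpa [abs_of_pos hx.1] using hx.2.le
    rintro (_ | n)
    · exact h0
    · refine PolyBounded.succ_of_deriv eventually_one_le_inv
        (Eventually.of_forall fun _ => zero_le_one) h0 ?_
      have : deriv (fun x : ℝ => x) = fun _ => 1 := by ext x; simp
      rw [this]
      exact PolyBounded.const 1
  · filter_upwards [self_mem_nhdsWithin] with x hx
    exact isOpen_ne.mem_nhds (ne_of_gt hx)
  · filter_upwards [self_mem_nhdsWithin] with x hx
    exact (abs_of_pos (inv_pos.2 hx)).le

namespace Frequencies

variable (Q : Frequencies)

/-- The derivatives of the exponent grow at most polynomially in `1 / x`, whatever the frequencies: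
on the `m`-th region `z m` is comparable to `1 / x`. -/
theorem polyBounded_expo (n : ℕ) : PolyBounded (𝓝[>] 0) (fun x => x⁻¹) 1 n Q.expo := by
  obtain ⟨D, hD0, hD⟩ := exists_abs_iteratedDeriv_le_of_support contDiff_slowBump
    (fun y hy => slowBump_eq_zero fun h => hy (Ioo_subset_Icc_self h)) n
  obtain ⟨h1, C, N, hC0, hC⟩ := polyBounded_inv n
  have hpos : ∀ᶠ x : ℝ in 𝓝[>] 0, 0 < x := self_mem_nhdsWithin
  refine ⟨hpos.mono fun x hx => Q.contDiffAt_expo hx,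
    C + 2 ^ n * ((108 + C) * (6 ^ n * D)), N + (2 + N + n), by positivity, ?_⟩
  filter_upwards [hpos, hC, eventually_one_le_inv] with x hx hx1 hx2 i hi
  simp only [Pi.one_apply, mul_one] at hx1 ⊢
  have e1 : x⁻¹ ^ N ≤ x⁻¹ ^ (N + (2 + N + n)) := pow_le_pow_right₀ hx2 (by omega)
  obtain ⟨m, -, hm⟩ := Q.exists_isolates hx
  have hinv : ContDiffAt ℝ ∞ (fun y : ℝ => y⁻¹) x := contDiffAt_inv ℝ hx.ne'
  by_cases hz : Q.z m * x ∈ Icc (3 : ℝ) 6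
  · have hb : ContDiff ℝ ∞ (fun y : ℝ => slowBump (Q.z m * y)) :=
      contDiff_slowBump.comp (contDiff_const.mul contDiff_id)
    have hl : ContDiffAt ℝ ∞ (fun y : ℝ => Q.level m - y⁻¹) x := contDiffAt_const.sub hinv
    have heq : Q.expo =ᶠ[𝓝 x] (fun y => y⁻¹) +
        fun y => (Q.level m - y⁻¹) * slowBump (Q.z m * y) := by
      filter_upwards [Isolates.eventually_mem hx] with y hy
      exact Q.expo_eq hm hy
    have hzx : Q.z m ≤ 6 * x⁻¹ := by
      rw [← div_eq_mul_inv, le_div_iff₀ hx]; exact hz.2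
    have hb' : ∀ j ≤ n, |iteratedDeriv j (fun y : ℝ => slowBump (Q.z m * y)) x|
        ≤ 6 ^ n * D * x⁻¹ ^ n := by
      intro j hj
      rw [iteratedDeriv_comp_const_mul (contDiff_slowBump.of_le (by exact_mod_cast le_top))]
      rw [abs_mul, abs_pow, abs_of_pos (Q.z_pos m)]
      calc Q.z m ^ j * |iteratedDeriv j slowBump (Q.z m * x)|
          ≤ (6 * x⁻¹) ^ j * D := by
            gcongr
            · exact (Q.z_pos m).le
            · exact hD j hj _
        _ ≤ (6 * x⁻¹) ^ n * D := by
            gcongr; linarith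
        _ = _ := by rw [mul_pow]; ring
    have hl' : ∀ j ≤ n, |iteratedDeriv j (fun y : ℝ => Q.level m - y⁻¹) x|
        ≤ (108 + C) * x⁻¹ ^ (2 + N) := by
      intro j hj
      have e2 : x⁻¹ ^ N ≤ x⁻¹ ^ (2 + N) := pow_le_pow_right₀ hx2 (by omega)
      have e3 : x⁻¹ ^ 2 ≤ x⁻¹ ^ (2 + N) := pow_le_pow_right₀ hx2 (by omega)
      have e4 : |iteratedDeriv j (fun _ : ℝ => Q.level m) x| ≤ 108 * x⁻¹ ^ 2 := by
        have h5 : Q.level m ≤ 108 * x⁻¹ ^ 2 := (Q.level_le m).trans (by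
          have := pow_le_pow_left₀ (Q.z_pos m).le hzx 2
          rw [mul_pow] at this; linarith)
        have h6 : 0 ≤ Q.level m := by linarith [Q.level_ge m, Q.z_pos m]
        rw [iteratedDeriv_const]
        split_ifs
        · rwa [abs_of_nonneg h6]
        · rw [abs_zero]; positivity
      have : iteratedDeriv j (fun y : ℝ => Q.level m - y⁻¹) x =
          iteratedDeriv j (fun _ : ℝ => Q.level m) x - iteratedDeriv j (fun y : ℝ => y⁻¹) x :=
        iteratedDeriv_sub contDiffAt_const (hinv.of_le (by exact_mod_cast le_top))
      rw [this]
      calc _ ≤ |iteratedDeriv j (fun _ : ℝ => Q.level m) x|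
            + |iteratedDeriv j (fun y : ℝ => y⁻¹) x| := abs_sub _ _
        _ ≤ 108 * x⁻¹ ^ 2 + C * x⁻¹ ^ N := add_le_add e4 (hx1 j hj)
        _ ≤ 108 * x⁻¹ ^ (2 + N) + C * x⁻¹ ^ (2 + N) := by gcongr
        _ = _ := by ring
    have hprod := abs_iteratedDeriv_mul_le hl hb.contDiffAt hl' hb' hi
    rw [heq.iteratedDeriv_eq, iteratedDeriv_add (hinv.of_le (by exact_mod_cast le_top))
      ((hl.mul hb.contDiffAt).of_le (by exact_mod_cast le_top))]
    have e5 : x⁻¹ ^ (2 + N) * x⁻¹ ^ n ≤ x⁻¹ ^ (N + (2 + N + n)) := by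
      rw [← pow_add]; exact pow_le_pow_right₀ hx2 (by omega)
    calc _ ≤ C * x⁻¹ ^ N + 2 ^ i * ((108 + C) * x⁻¹ ^ (2 + N) * (6 ^ n * D * x⁻¹ ^ n)) :=
          (abs_add_le _ _).trans (add_le_add (hx1 i hi) hprod)
      _ ≤ C * x⁻¹ ^ N + 2 ^ n * ((108 + C) * x⁻¹ ^ (2 + N) * (6 ^ n * D * x⁻¹ ^ n)) := by
          gcongr; norm_num
      _ = C * x⁻¹ ^ N + 2 ^ n * ((108 + C) * (6 ^ n * D)) * (x⁻¹ ^ (2 + N) * x⁻¹ ^ n) := by ring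
      _ ≤ C * x⁻¹ ^ (N + (2 + N + n)) +
          2 ^ n * ((108 + C) * (6 ^ n * D)) * x⁻¹ ^ (N + (2 + N + n)) := by gcongr
      _ = _ := by ring
  · have heq : Q.expo =ᶠ[𝓝 x] fun y => y⁻¹ := by
      have hc : ∀ᶠ y in 𝓝 x, Q.z m * y ∉ Icc (3 : ℝ) 6 :=
        (continuous_const.mul continuous_id).continuousAt.eventually
          (isClosed_Icc.isOpen_compl.mem_nhds hz)
      filter_upwards [Isolates.eventually_mem hx, hc] with y hy hy'
      rw [Q.expo_eq hm hy, slowBump_eq_zero fun h => hy' (Ioo_subset_Icc_self h)]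
      simp
    rw [heq.iteratedDeriv_eq]
    calc _ ≤ C * x⁻¹ ^ N := hx1 i hi
      _ ≤ (C + 2 ^ n * ((108 + C) * (6 ^ n * D))) * x⁻¹ ^ (N + (2 + N + n)) := by
        gcongr
        have : 0 ≤ 2 ^ n * ((108 + C) * (6 ^ n * D)) := by positivity
        linarith

theorem polyBounded_exp_expo (σ : ℝ) (n : ℕ) : PolyBounded (𝓝[>] 0) (fun x => x⁻¹)
    (fun x => Real.exp (σ * Q.expo x)) n (fun x => Real.exp (σ * Q.expo x)) := by
  have hpos : ∀ᶠ x : ℝ in 𝓝[>] 0, 0 < x := self_mem_nhdsWithin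
  refine (PolyBounded.of_deriv_eq_mul (n := n) (G := fun x => σ * deriv Q.expo x)
    eventually_one_le_inv ?_ ?_ ?_ ?_).mono_order (Nat.le_succ n)
  · filter_upwards [hpos] with x hx
    exact (contDiffAt_const.mul (Q.contDiffAt_expo hx)).exp
  · exact Eventually.of_forall fun x => abs_of_pos (Real.exp_pos _)
  · exact (PolyBounded.const σ).mul_one_left (Q.polyBounded_expo (n + 1)).deriv
  · filter_upwards [hpos] with x hx
    filter_upwards [Ioi_mem_nhds hx] with y hy
    have := (((Q.contDiffAt_expo hy).differentiableAt (by simp)).hasDerivAt.const_mul σ).exp.deriv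
    rw [this]; ring

/-- The base vector field on `(0, ∞)`. Its values elsewhere are irrelevant. -/
noncomputable def baseField (x : ℝ) : ℝ := -Real.exp (-Q.expo x)

theorem baseField_neg (x : ℝ) : Q.baseField x < 0 := neg_neg_of_pos (Real.exp_pos _)

theorem abs_baseField (x : ℝ) : |Q.baseField x| = Real.exp (-Q.expo x) := by
  rw [baseField, abs_neg, abs_of_pos (Real.exp_pos _)]

theorem contDiffAt_baseField {x : ℝ} (hx : 0 < x) : ContDiffAt ℝ ∞ Q.baseField x :=
  (Q.contDiffAt_expo hx).neg.exp.neg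

theorem polyBounded_baseField (n : ℕ) : PolyBounded (𝓝[>] 0) (fun x => x⁻¹)
    (fun x => Real.exp (-Q.expo x)) n Q.baseField := by
  have := (Q.polyBounded_exp_expo (-1) n).neg
  simp only [neg_one_mul] at this
  exact this

theorem tendsto_inv_pow_mul_exp_neg_expo (C : ℝ) (N : ℕ) :
    Tendsto (fun x => C * x⁻¹ ^ N * Real.exp (-Q.expo x)) (𝓝[>] 0) (𝓝 0) := by
  have h1 : Tendsto (fun x : ℝ => |C| * (x⁻¹ ^ N * Real.exp (-x⁻¹))) (𝓝[>] 0) (𝓝 (|C| * 0)) :=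
    ((Real.tendsto_pow_mul_exp_neg_atTop_nhds_zero N).comp tendsto_inv_nhdsGT_zero).const_mul _
  rw [mul_zero] at h1
  refine squeeze_zero_norm' ?_ h1
  filter_upwards [self_mem_nhdsWithin] with x hx
  have hx : (0 : ℝ) < x := hx
  rw [Real.norm_eq_abs, abs_mul, abs_mul, abs_of_pos (Real.exp_pos _), abs_pow,
    abs_of_pos (inv_pos.2 hx), mul_assoc]
  gcongr
  exact Q.inv_le_expo hx

/-- The base flow in time coordinate: an integral curve of the base field running through all of
`(0, ∞)`, and its inverse. -/
theorem exists_baseCurve : ∃ φ τ : ℝ → ℝ, (∀ u, 0 < φ u) ∧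
    (∀ u, HasDerivAt φ (Q.baseField (φ u)) u) ∧ (∀ u, τ (φ u) = u) ∧
    (∀ x, 0 < x → φ (τ x) = x) ∧ (∀ x, 0 < x → HasDerivAt τ (Q.baseField x)⁻¹ x) := by
  -- In the variable `y = -log x` the travel time is an increasing bijection of the line.
  set k : ℝ → ℝ := fun y => Real.exp (Q.expo (Real.exp (-y)) - y) with hk
  have hkc : Continuous k := by
    refine Real.continuous_exp.comp (Continuous.sub ?_ continuous_id)
    refine continuous_iff_continuousAt.2 fun y => ?_
    exact ContinuousAt.comp (f := fun y => Real.exp (-y)) (g := Q.expo)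
      (Q.contDiffAt_expo (Real.exp_pos _)).continuousAt
      (Real.continuous_exp.comp continuous_neg).continuousAt
  set T : ℝ → ℝ := fun y => ∫ s in (0 : ℝ)..y, k s with hT
  have hTd : ∀ y, HasDerivAt T (k y) y := fun y => (hkc.integral_hasStrictDerivAt 0 y).hasDerivAt
  have hk1 : ∀ y, 1 ≤ k y := fun y => by
    have h1 := Q.inv_le_expo (Real.exp_pos (-y))
    rw [← Real.exp_neg, neg_neg] at h1
    have h2 := Real.add_one_le_exp y
    exact Real.one_le_exp (by linarith)
  obtain ⟨S, hST, hTS, hSd⟩ := exists_inverse_of_deriv_ge zero_lt_one hTd hk1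
  refine ⟨fun u => Real.exp (-S u), fun x => T (-Real.log x), fun u => Real.exp_pos _,
    fun u => ?_, fun u => ?_, fun x hx => ?_, fun x hx => ?_⟩
  · have := (hSd u).neg.exp
    refine this.congr_deriv (Eq.symm ?_)
    change -Real.exp (-Q.expo (Real.exp (-S u))) =
      Real.exp (-S u) * -(Real.exp (Q.expo (Real.exp (-S u)) - S u))⁻¹
    rw [← Real.exp_neg, neg_sub, mul_neg, ← Real.exp_add]
    congr 2; ring
  · simp [hTS]
  · simp only [hST, neg_neg]; exact Real.exp_log hx
  · have := (hTd (-Real.log x)).comp x (Real.hasDerivAt_log hx.ne').neg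
    refine this.congr_deriv (Eq.symm ?_)
    change (-Real.exp (-Q.expo x))⁻¹ =
      Real.exp (Q.expo (Real.exp (-(-Real.log x))) - -Real.log x) * -x⁻¹
    rw [neg_neg, Real.exp_log hx, sub_neg_eq_add, Real.exp_add, Real.exp_log hx, Real.exp_neg]
    field_simp

end Frequencies

/-! ### The base flow -/

/-- Finitely many bounds by powers of a gauge `W ≥ 1` can share the constant and the power. -/
theorem exists_uniform_bound {l : Filter ℝ} {W : ℝ → ℝ} (hW : ∀ᶠ t in l, 1 ≤ W t)
    {b M : ℕ → ℝ → ℝ} (hM : ∀ i t, 0 ≤ M i t)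
    (h : ∀ i, ∃ (C : ℝ) (N : ℕ), 0 ≤ C ∧ ∀ᶠ t in l, b i t ≤ C * W t ^ N * M i t) (k : ℕ) :
    ∃ (C : ℝ) (N : ℕ), 0 ≤ C ∧ ∀ᶠ t in l, ∀ i ≤ k, b i t ≤ C * W t ^ N * M i t := by
  choose C N hC h using h
  refine ⟨∑ i ∈ Finset.range (k + 1), C i, ∑ i ∈ Finset.range (k + 1), N i,
    Finset.sum_nonneg fun i _ => hC i, ?_⟩
  have hall : ∀ᶠ t in l, ∀ i ∈ Finset.range (k + 1), b i t ≤ C i * W t ^ N i * M i t :=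
    (Finset.eventually_all _).2 fun i _ => h i
  filter_upwards [hall, hW] with t ht hw i hi
  have hi' : i ∈ Finset.range (k + 1) := Finset.mem_range.2 (by omega)
  have e1 : C i ≤ ∑ i ∈ Finset.range (k + 1), C i :=
    Finset.single_le_sum (fun i _ => hC i) hi'
  have e2 : N i ≤ ∑ i ∈ Finset.range (k + 1), N i :=
    Finset.single_le_sum (fun i _ => Nat.zero_le _) hi'
  have hw0 : 0 ≤ W t := zero_le_one.trans hw
  calc b i t ≤ C i * W t ^ N i * M i t := ht i hi'
    _ ≤ _ := by
      gcongr
      · exact hM i t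
      · exact (hC i).trans e1

theorem eventually_abs_sub_le_of_tendsto_deriv {F F' : ℝ → ℝ} (hF : ∀ t, HasDerivAt F (F' t) t)
    (h : Tendsto F' atTop (𝓝 0)) (R : ℝ) {c : ℝ} (hc : 0 < c) :
    ∀ᶠ t in atTop, ∀ u, |u - t| ≤ R → |F u - F t| ≤ c := by
  have hR : 0 < |R| + 1 := by positivity
  have h1 : ∀ᶠ t in atTop, |F' t| ≤ c / (|R| + 1) := by
    have hp : |(0 : ℝ)| < c / (|R| + 1) := by rw [abs_zero]; positivity
    exact h.abs.eventually_le_const hp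
  obtain ⟨T, hT⟩ := eventually_atTop.1 h1
  filter_upwards [eventually_ge_atTop (T + |R|)] with t ht u hu
  have hRR := le_abs_self R
  have hu' := abs_le.1 hu
  have := (convex_Ici T).norm_image_sub_le_of_norm_hasDerivWithin_le (f := F) (f' := F')
    (C := c / (|R| + 1)) (fun x _ => (hF x).hasDerivWithinAt) (fun x hx => hT x hx)
    (show t ∈ Ici T by simp only [mem_Ici]; linarith [abs_nonneg R])
    (show u ∈ Ici T by simp only [mem_Ici]; linarith)
  calc |F u - F t| ≤ c / (|R| + 1) * |u - t| := this
    _ ≤ c / (|R| + 1) * (|R| + 1) := by gcongr; linarith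
    _ = c := div_mul_cancel₀ _ hR.ne'

theorem PolyBounded.of_tendsto {F : ℝ → ℝ} (hF : ContDiff ℝ ∞ F)
    (h : ∀ k, Tendsto (iteratedDeriv k F) atTop (𝓝 0)) (n : ℕ) : PolyBounded atTop 1 1 n F := by
  refine ⟨Eventually.of_forall fun t => hF.contDiffAt, 1, 0, zero_le_one, ?_⟩
  have hall : ∀ᶠ t in atTop, ∀ i ∈ Finset.range (n + 1), |iteratedDeriv i F t| ≤ 1 :=
    (Finset.eventually_all _).2 fun i _ =>
      (h i).abs.eventually_le_const (by simp)
  filter_upwards [hall] with t ht i hi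
  simpa using ht i (Finset.mem_range.2 (by omega))

namespace Frequencies

variable (Q : Frequencies)

/-- A reference integral curve of the base field, which runs through all of `(0, ∞)`. -/
noncomputable def curve : ℝ → ℝ := Q.exists_baseCurve.choose

/-- The inverse of `curve`: the time at which the reference integral curve visits a point. -/
noncomputable def time : ℝ → ℝ := Q.exists_baseCurve.choose_spec.choose

theorem curve_pos (u : ℝ) : 0 < Q.curve u := Q.exists_baseCurve.choose_spec.choose_spec.1 u

theorem hasDerivAt_curve (u : ℝ) : HasDerivAt Q.curve (Q.baseField (Q.curve u)) u :=
  Q.exists_baseCurve.choose_spec.choose_spec.2.1 u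

@[simp] theorem time_curve (u : ℝ) : Q.time (Q.curve u) = u :=
  Q.exists_baseCurve.choose_spec.choose_spec.2.2.1 u

theorem curve_time {x : ℝ} (hx : 0 < x) : Q.curve (Q.time x) = x :=
  Q.exists_baseCurve.choose_spec.choose_spec.2.2.2.1 x hx

theorem hasDerivAt_time {x : ℝ} (hx : 0 < x) : HasDerivAt Q.time (Q.baseField x)⁻¹ x :=
  Q.exists_baseCurve.choose_spec.choose_spec.2.2.2.2 x hx

theorem curve_strictAnti : StrictAnti Q.curve :=
  strictAnti_of_deriv_neg fun u => by
    rw [(Q.hasDerivAt_curve u).deriv]; exact Q.baseField_neg _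

theorem contDiff_curve : ContDiff ℝ ∞ Q.curve := by
  refine contDiff_infty.2 fun n => ?_
  induction n with
  | zero =>
    exact contDiff_zero.2
      (continuous_iff_continuousAt.2 fun u => (Q.hasDerivAt_curve u).continuousAt)
  | succ n ih =>
    rw [Nat.cast_add, Nat.cast_one, contDiff_succ_iff_deriv]
    refine ⟨fun u => (Q.hasDerivAt_curve u).differentiableAt, fun h => by simp at h, ?_⟩
    have : deriv Q.curve = Q.baseField ∘ Q.curve := funext fun u => (Q.hasDerivAt_curve u).deriv
    rw [this]
    exact contDiff_iff_contDiffAt.2 fun u =>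
      ((Q.contDiffAt_baseField (Q.curve_pos u)).of_le (by exact_mod_cast le_top)).comp u
        ih.contDiffAt

theorem contDiffOn_time : ContDiffOn ℝ ∞ Q.time (Ioi 0) := by
  rw [contDiffOn_infty_iff_deriv_of_isOpen isOpen_Ioi]
  refine ⟨fun x hx => (Q.hasDerivAt_time hx).differentiableAt.differentiableWithinAt, ?_⟩
  have : ContDiffOn ℝ ∞ (fun x => (Q.baseField x)⁻¹) (Ioi 0) := fun x hx =>
    ((Q.contDiffAt_baseField hx).inv (Q.baseField_neg x).ne).contDiffWithinAt
  exact this.congr fun x hx => (Q.hasDerivAt_time hx).deriv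

theorem tendsto_curve : Tendsto Q.curve atTop (𝓝[>] 0) := by
  rw [tendsto_nhdsWithin_iff]
  refine ⟨?_, Eventually.of_forall fun u => Q.curve_pos u⟩
  refine tendsto_order.2 ⟨fun a ha => Eventually.of_forall fun u => ha.trans (Q.curve_pos u),
    fun a ha => ?_⟩
  filter_upwards [eventually_gt_atTop (Q.time a)] with u hu
  calc Q.curve u < Q.curve (Q.time a) := Q.curve_strictAnti hu
    _ = a := Q.curve_time ha

theorem tendsto_time : Tendsto Q.time (𝓝[>] 0) atTop := by
  refine tendsto_atTop.2 fun b => ?_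
  filter_upwards [Ioo_mem_nhdsGT (Q.curve_pos b)] with x hx
  rw [← Q.curve_strictAnti.le_iff_ge, Q.curve_time hx.1]
  exact hx.2.le

/-- The speed of the base flow along the reference curve. -/
noncomputable def speed (t : ℝ) : ℝ := Real.exp (-Q.expo (Q.curve t))

theorem speed_pos (t : ℝ) : 0 < Q.speed t := Real.exp_pos _

theorem exp_expo_curve (t : ℝ) : Real.exp (Q.expo (Q.curve t)) = (Q.speed t)⁻¹ := by
  rw [speed, Real.exp_neg, inv_inv]

theorem speed_lt_one (t : ℝ) : Q.speed t < 1 := by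
  have := Q.inv_le_expo (Q.curve_pos t)
  have h2 := inv_pos.2 (Q.curve_pos t)
  exact Real.exp_lt_one_iff.2 (by linarith)

theorem tendsto_curve_inv_pow_mul_speed (C : ℝ) (N : ℕ) :
    Tendsto (fun t => C * (Q.curve t)⁻¹ ^ N * Q.speed t) atTop (𝓝 0) :=
  (Q.tendsto_inv_pow_mul_exp_neg_expo C N).comp Q.tendsto_curve

theorem eventually_one_le_curve_inv : ∀ᶠ t in atTop, 1 ≤ (Q.curve t)⁻¹ :=
  Q.tendsto_curve.eventually eventually_one_le_inv

/-- Each time derivative along the base flow gains one factor `speed`. -/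
theorem exists_abs_iteratedDeriv_comp_curve_le {P M : ℝ → ℝ} (hM : ∀ x, 0 ≤ M x)
    (hP : ∀ x, 0 < x → ContDiffAt ℝ ∞ P x) (hPb : ∀ n, PolyBounded (𝓝[>] 0) (fun x => x⁻¹) M n P)
    (k : ℕ) : ∃ (C : ℝ) (N : ℕ), 0 ≤ C ∧ ∀ᶠ t in atTop, ∀ i ≤ k,
      |iteratedDeriv i (P ∘ Q.curve) t| ≤
        C * (Q.curve t)⁻¹ ^ N * (Q.speed t ^ i * M (Q.curve t)) := by
  refine exists_uniform_bound Q.eventually_one_le_curve_inv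
    (b := fun i t => |iteratedDeriv i (P ∘ Q.curve) t|)
    (M := fun i t => Q.speed t ^ i * M (Q.curve t))
    (fun i t => mul_nonneg (pow_nonneg (Q.speed_pos t).le _) (hM _)) (fun i => ?_) k
  obtain ⟨C₀, hC₀, hop⟩ := exists_abs_iterate_fieldDeriv_le i
  obtain ⟨-, C₁, N₁, hC₁, h₁⟩ := Q.polyBounded_baseField i
  obtain ⟨-, C₂, N₂, hC₂, h₂⟩ := hPb i
  refine ⟨C₀ * C₁ ^ i * ((i + 1) * C₂), N₁ * i + N₂, by positivity, ?_⟩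
  filter_upwards [Q.tendsto_curve.eventually h₁, Q.tendsto_curve.eventually h₂] with t h₁ h₂
  have hx := Q.curve_pos t
  have hs := Q.speed_pos t
  rw [iteratedDeriv_comp_eq_iterate_fieldDeriv isOpen_univ (fun u _ => Q.hasDerivAt_curve u)
    (fun u _ => Q.contDiffAt_baseField (Q.curve_pos u)) i P (fun u _ => hP _ (Q.curve_pos u)) t
    (mem_univ t)]
  refine (hop Q.baseField P (Q.curve t) (C₁ * (Q.curve t)⁻¹ ^ N₁ * Q.speed t) 1 (by positivity)
    zero_le_one (Q.contDiffAt_baseField hx) (hP _ hx)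
    (fun j hj => by simpa [speed] using h₁ j hj)).trans ?_
  have hsum : ∑ j ∈ Finset.range (i + 1), (1 : ℝ) ^ j * |iteratedDeriv j P (Q.curve t)| ≤
      (i + 1) * (C₂ * (Q.curve t)⁻¹ ^ N₂ * M (Q.curve t)) := by
    refine (Finset.sum_le_card_nsmul _ _ (C₂ * (Q.curve t)⁻¹ ^ N₂ * M (Q.curve t))
      fun j hj => ?_).trans (by simp)
    simpa using h₂ j (Nat.lt_succ_iff.1 (Finset.mem_range.1 hj))
  calc _ ≤ C₀ * (C₁ * (Q.curve t)⁻¹ ^ N₁ * Q.speed t) ^ i *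
        ((i + 1) * (C₂ * (Q.curve t)⁻¹ ^ N₂ * M (Q.curve t))) :=
        mul_le_mul_of_nonneg_left hsum (by positivity)
    _ = _ := by rw [mul_pow, mul_pow, pow_add, pow_mul]; ring

theorem exists_abs_iteratedDeriv_curve_le (k : ℕ) : ∃ (C : ℝ) (N : ℕ), 0 ≤ C ∧
    ∀ᶠ t in atTop, ∀ i ≤ k, |iteratedDeriv (i + 1) Q.curve t| ≤
      C * (Q.curve t)⁻¹ ^ N * Q.speed t ^ (i + 1) := by
  obtain ⟨C, N, hC, h⟩ := Q.exists_abs_iteratedDeriv_comp_curve_le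
    (fun x => (Real.exp_pos (-Q.expo x)).le) (fun x hx => Q.contDiffAt_baseField hx)
    Q.polyBounded_baseField k
  refine ⟨C, N, hC, h.mono fun t ht i hi => ?_⟩
  have : deriv Q.curve = Q.baseField ∘ Q.curve := funext fun u => (Q.hasDerivAt_curve u).deriv
  rw [iteratedDeriv_succ', this, pow_succ]
  exact ht i hi

theorem tendsto_iteratedDeriv_curve (k : ℕ) :
    Tendsto (iteratedDeriv k Q.curve) atTop (𝓝 0) := by
  rcases k with _ | k
  · rw [iteratedDeriv_zero]; exact Q.tendsto_curve.mono_right nhdsWithin_le_nhds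
  · obtain ⟨C, N, hC, h⟩ := Q.exists_abs_iteratedDeriv_curve_le k
    refine squeeze_zero_norm' ?_ (Q.tendsto_curve_inv_pow_mul_speed C N)
    filter_upwards [h] with t ht
    have hx := Q.curve_pos t
    refine (ht k le_rfl).trans ?_
    gcongr
    calc Q.speed t ^ (k + 1) ≤ Q.speed t ^ 1 :=
          pow_le_pow_of_le_one (Q.speed_pos t).le (Q.speed_lt_one t).le (by omega)
      _ = Q.speed t := pow_one _

theorem polyBounded_curve (n : ℕ) : PolyBounded atTop 1 1 n Q.curve :=
  PolyBounded.of_tendsto Q.contDiff_curve Q.tendsto_iteratedDeriv_curve n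

/-- Over bounded times the base flow moves points by a small proportion only. -/
theorem eventually_curve_near (R : ℝ) : ∀ᶠ t in atTop, ∀ u, |u - t| ≤ R →
    19 / 20 * Q.curve t ≤ Q.curve u ∧ Q.curve u ≤ 21 / 20 * Q.curve t := by
  have hd : ∀ t, HasDerivAt (fun t => Real.log (Q.curve t))
      (Q.baseField (Q.curve t) / Q.curve t) t := fun t =>
    (Q.hasDerivAt_curve t).log (Q.curve_pos t).ne'
  have ht : Tendsto (fun t => Q.baseField (Q.curve t) / Q.curve t) atTop (𝓝 0) := by
    refine squeeze_zero_norm (fun t => ?_) (Q.tendsto_curve_inv_pow_mul_speed 1 1)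
    rw [Real.norm_eq_abs, abs_div, Q.abs_baseField, abs_of_pos (Q.curve_pos t), speed, one_mul,
      pow_one, div_eq_inv_mul]
  filter_upwards [eventually_abs_sub_le_of_tendsto_deriv hd ht R
    (show (0 : ℝ) < 1 / 30 by norm_num)] with t h u hu
  have h1 := abs_le.1 (h u hu)
  have hx := Q.curve_pos t
  have hy := Q.curve_pos u
  have e : Q.curve u = Q.curve t * Real.exp (Real.log (Q.curve u) - Real.log (Q.curve t)) := by
    rw [Real.exp_sub, Real.exp_log hx, Real.exp_log hy]; field_simp
  set d := Real.log (Q.curve u) - Real.log (Q.curve t) with hdd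
  have l1 := Real.add_one_le_exp d
  have l2 := Real.add_one_le_exp (-d)
  have l3 : Real.exp d * Real.exp (-d) = 1 := by rw [← Real.exp_add]; simp
  have l4 : 29 / 30 ≤ Real.exp (-d) := by linarith [h1.2]
  have l5 : Real.exp d ≤ 21 / 20 := by nlinarith [Real.exp_pos d]
  rw [e]
  constructor
  · nlinarith [h1.1]
  · nlinarith

/-- Over bounded times the speed of the base flow at most doubles. -/
theorem eventually_speed_le (R : ℝ) : ∀ᶠ t in atTop, ∀ u, |u - t| ≤ R →
    Q.speed u ≤ 2 * Q.speed t := by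
  have hd : ∀ t, HasDerivAt (fun t => Q.expo (Q.curve t))
      (deriv Q.expo (Q.curve t) * Q.baseField (Q.curve t)) t := fun t =>
    (((Q.contDiffAt_expo (Q.curve_pos t)).differentiableAt (by simp)).hasDerivAt).comp t
      (Q.hasDerivAt_curve t)
  have ht : Tendsto (fun t => deriv Q.expo (Q.curve t) * Q.baseField (Q.curve t))
      atTop (𝓝 0) := by
    obtain ⟨-, C, N, hC, h⟩ := Q.polyBounded_expo 1
    refine squeeze_zero_norm' ?_ (Q.tendsto_curve_inv_pow_mul_speed C N)
    filter_upwards [Q.tendsto_curve.eventually h] with t ht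
    rw [Real.norm_eq_abs, abs_mul, Q.abs_baseField]
    have := ht 1 le_rfl
    rw [iteratedDeriv_one, Pi.one_apply, mul_one] at this
    exact mul_le_mul_of_nonneg_right this (Real.exp_pos _).le
  filter_upwards [eventually_abs_sub_le_of_tendsto_deriv hd ht R
    (show (0 : ℝ) < 1 / 2 by norm_num)] with t h u hu
  have h1 := abs_le.1 (h u hu)
  have e : Q.speed u = Real.exp (-(Q.expo (Q.curve u) - Q.expo (Q.curve t))) * Q.speed t := by
    rw [speed, speed, ← Real.exp_add]; congr 1; ring
  rw [e]
  refine mul_le_mul_of_nonneg_right ?_ (Q.speed_pos t).le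
  set d := Q.expo (Q.curve u) - Q.expo (Q.curve t)
  have l2 := Real.add_one_le_exp d
  have l3 : Real.exp d * Real.exp (-d) = 1 := by rw [← Real.exp_add]; simp
  nlinarith [Real.exp_pos (-d)]

/-- The time-`s` map of the base field, extended by the identity to `(-∞, 0]`. -/
noncomputable def baseMap (s x : ℝ) : ℝ := if 0 < x then Q.curve (Q.time x + s) else x

/-- The displacement of the base flow, `u ↦ curve (u + s) - curve u`, tends to `0` together with all
its derivatives in the space variable. This holds because the exponent of the base field is
polynomially bounded in `1 / x`, hence insensitive to a bounded lapse of time. -/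
theorem tendsto_iterate_fieldDeriv_curve_sub (s : ℝ) (k : ℕ) :
    Tendsto ((fieldDeriv fun u => (Q.baseField (Q.curve u))⁻¹)^[k]
      fun u => Q.curve (u + s) - Q.curve u) atTop (𝓝 0) := by
  set g : ℝ → ℝ := fun u => (Q.baseField (Q.curve u))⁻¹ with hg
  set Ψ : ℝ → ℝ := fun u => Q.curve (u + s) - Q.curve u with hΨ
  have hΨs : ContDiff ℝ ∞ Ψ :=
    (Q.contDiff_curve.comp (contDiff_id.add contDiff_const)).sub Q.contDiff_curve
  have hgs : ∀ t, ContDiffAt ℝ ∞ g t := fun t =>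
    ((Q.contDiffAt_baseField (Q.curve_pos t)).comp t Q.contDiff_curve.contDiffAt).inv
      (Q.baseField_neg _).ne
  have hgP : g = (fun x => -Real.exp (1 * Q.expo x)) ∘ Q.curve := by
    funext u
    simp only [hg, Function.comp, baseField, inv_neg, ← Real.exp_neg, neg_neg, one_mul]
  obtain ⟨C₀, hC₀, hop⟩ := exists_abs_iterate_fieldDeriv_le k
  obtain ⟨C₁, N₁, hC₁, h₁⟩ := Q.exists_abs_iteratedDeriv_comp_curve_le
    (fun x => (Real.exp_pos (1 * Q.expo x)).le)
    (fun x hx => ((contDiffAt_const.mul (Q.contDiffAt_expo hx)).exp.neg))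
    (fun n => (Q.polyBounded_exp_expo 1 n).neg) k
  obtain ⟨C₂, N₂, hC₂, h₂⟩ := Q.exists_abs_iteratedDeriv_curve_le k
  obtain ⟨T, hT⟩ := eventually_atTop.1 h₂
  refine squeeze_zero_norm' ?_ (Q.tendsto_curve_inv_pow_mul_speed
    (C₀ * C₁ ^ k * ((k + 1) * (C₂ * 2 ^ N₂ * 2 ^ (k + 1) * |s|))) (N₁ * k + N₂))
  filter_upwards [h₁, eventually_ge_atTop (T + |s|), Q.eventually_curve_near |s|,
    Q.eventually_speed_le |s|] with t h₁ ht hnear hspeed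
  have hx := Q.curve_pos t
  have hsp := Q.speed_pos t
  -- Each space derivative costs a factor `1 / speed`, so the weight is `w = 1 / speed`; each time
  -- derivative of the displacement gains a factor `speed` in return, and one such factor is left.
  have hop' := hop g Ψ t (C₁ * (Q.curve t)⁻¹ ^ N₁) (Q.speed t)⁻¹ (by positivity) (by positivity)
    (hgs t) hΨs.contDiffAt fun i hi => by
      have := h₁ i hi
      rw [← hgP, one_mul, Q.exp_expo_curve] at this
      calc _ ≤ C₁ * (Q.curve t)⁻¹ ^ N₁ * (Q.speed t ^ i * (Q.speed t)⁻¹) * (Q.speed t)⁻¹ ^ i := by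
            gcongr
        _ = C₁ * (Q.curve t)⁻¹ ^ N₁ * (Q.speed t)⁻¹ * (Q.speed t * (Q.speed t)⁻¹) ^ i := by
            rw [mul_pow]; ring
        _ = _ := by rw [mul_inv_cancel₀ hsp.ne', one_pow, mul_one]
  have hterm : ∀ j ∈ Finset.range (k + 1), (Q.speed t)⁻¹ ^ j * |iteratedDeriv j Ψ t| ≤
      C₂ * 2 ^ N₂ * 2 ^ (k + 1) * |s| * ((Q.curve t)⁻¹ ^ N₂ * Q.speed t) := by
    intro j hj
    have hjk : j ≤ k := Nat.lt_succ_iff.1 (Finset.mem_range.1 hj)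
    have e1 : iteratedDeriv j Ψ t =
        iteratedDeriv j Q.curve (t + s) - iteratedDeriv j Q.curve t := by
      have h3 : ContDiffAt ℝ j (fun u => Q.curve (u + s)) t :=
        ((Q.contDiff_curve.comp (contDiff_id.add contDiff_const)).of_le
          (by exact_mod_cast le_top)).contDiffAt
      have h4 : ContDiffAt ℝ j Q.curve t :=
        (Q.contDiff_curve.of_le (by exact_mod_cast le_top)).contDiffAt
      have := iteratedDeriv_sub h3 h4
      rw [iteratedDeriv_comp_add_const] at this
      exact this
    have e2 := (convex_Icc (t - |s|) (t + |s|)).norm_image_sub_le_of_norm_deriv_le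
      (f := iteratedDeriv j Q.curve) (x := t) (y := t + s)
      (C := C₂ * (2 * (Q.curve t)⁻¹) ^ N₂ * (2 * Q.speed t) ^ (j + 1))
      (fun x _ => (Q.contDiff_curve.differentiable_iteratedDeriv j
        (by exact_mod_cast WithTop.coe_lt_top _)).differentiableAt) (fun u hu => by
        have hu' : |u - t| ≤ |s| := abs_le.2 ⟨by linarith [hu.1], by linarith [hu.2]⟩
        have h5 := hT u (by linarith [hu.1]) j hjk
        rw [iteratedDeriv_succ] at h5
        have h6 : (Q.curve u)⁻¹ ≤ 2 * (Q.curve t)⁻¹ := by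
          rw [← inv_inv (2 : ℝ), ← mul_inv]
          exact inv_anti₀ (by positivity) (by linarith [(hnear u hu').1])
        have h7 := hspeed u hu'
        have h8 := Q.curve_pos u
        have h9 := Q.speed_pos u
        rw [Real.norm_eq_abs]
        exact h5.trans (by gcongr))
      ⟨by linarith [abs_nonneg s], by linarith [abs_nonneg s]⟩
      ⟨by linarith [neg_abs_le s], by linarith [le_abs_self s]⟩
    rw [e1]
    simp only [Real.norm_eq_abs, add_sub_cancel_left] at e2
    calc _ ≤ (Q.speed t)⁻¹ ^ j *
          (C₂ * (2 * (Q.curve t)⁻¹) ^ N₂ * (2 * Q.speed t) ^ (j + 1) * |s|) := by gcongr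
      _ = C₂ * 2 ^ N₂ * 2 ^ (j + 1) * |s| * ((Q.curve t)⁻¹ ^ N₂ * Q.speed t) *
          ((Q.speed t)⁻¹ * Q.speed t) ^ j := by
          rw [mul_pow, mul_pow, mul_pow, pow_succ (Q.speed t)]; ring
      _ = C₂ * 2 ^ N₂ * 2 ^ (j + 1) * |s| * ((Q.curve t)⁻¹ ^ N₂ * Q.speed t) := by
          rw [inv_mul_cancel₀ hsp.ne', one_pow, mul_one]
      _ ≤ _ := by
          gcongr; norm_num
  refine hop'.trans ?_
  calc _ ≤ C₀ * (C₁ * (Q.curve t)⁻¹ ^ N₁) ^ k * ((k + 1 : ℕ) •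
        (C₂ * 2 ^ N₂ * 2 ^ (k + 1) * |s| * ((Q.curve t)⁻¹ ^ N₂ * Q.speed t))) := by
        refine mul_le_mul_of_nonneg_left ?_ (by positivity)
        simpa using Finset.sum_le_card_nsmul _ _ _ hterm
    _ = _ := by
        rw [nsmul_eq_mul, mul_pow C₁, ← pow_mul, pow_add _ (N₁ * k)]; push_cast; ring

/-- All time-`s` maps of the base field are smooth up to the origin. -/
theorem contDiff_baseMap (s : ℝ) : ContDiff ℝ ∞ (Q.baseMap s) := by
  set r : ℝ → ℝ := fun x => if 0 < x then Q.curve (Q.time x + s) - x else 0 with hr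
  have hEq : ∀ x ∈ Ioi (0 : ℝ), r x = Q.curve (Q.time x + s) - x := fun x hx => if_pos hx
  have hrc : ContDiff ℝ ∞ r := by
    refine contDiff_infty_of_flat (fun x hx => if_neg (not_lt.2 hx)) ?_ fun k => ?_
    · refine ContDiffOn.congr ?_ hEq
      exact (Q.contDiff_curve.comp_contDiffOn (Q.contDiffOn_time.add contDiffOn_const)).sub
        contDiffOn_id
    · refine ((Q.tendsto_iterate_fieldDeriv_curve_sub s k).comp Q.tendsto_time).congr' ?_
      filter_upwards [self_mem_nhdsWithin] with x hx
      have hx : 0 < x := hx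
      rw [Function.comp_apply,
        ← iteratedDeriv_comp_eq_iterate_fieldDeriv (τ := Q.time) isOpen_Ioi ?_ ?_ k _ ?_ x hx]
      · apply Filter.EventuallyEq.iteratedDeriv_eq
        filter_upwards [Ioi_mem_nhds hx] with y hy
        rw [hEq y hy, Function.comp_apply, Q.curve_time hy]
      · intro y hy
        rw [Q.curve_time hy]; exact Q.hasDerivAt_time hy
      · intro y _
        exact ((Q.contDiffAt_baseField (Q.curve_pos _)).comp _ Q.contDiff_curve.contDiffAt).inv
          (Q.baseField_neg _).ne
      · intro y _
        exact ((Q.contDiff_curve.comp (contDiff_id.add contDiff_const)).sub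
          Q.contDiff_curve).contDiffAt
  have : Q.baseMap s = fun x => x + r x := by
    funext x
    simp only [baseMap, hr]
    split_ifs <;> ring
  rw [this]
  exact contDiff_id.add hrc

end Frequencies

/-! ### The oscillating time change -/

theorem abs_iteratedDeriv_sin_mul_le (a : ℝ) (k : ℕ) (t : ℝ) :
    |iteratedDeriv k (fun t => Real.sin (a * t)) t| ≤ |a| ^ k := by
  rw [iteratedDeriv_comp_const_mul Real.contDiff_sin, abs_mul, abs_pow]
  exact mul_le_of_le_one_right (by positivity) (Real.abs_iteratedDeriv_sin_le_one k _)

theorem abs_iteratedDeriv_sin_sub_le (a θ : ℝ) (k : ℕ) (t : ℝ) :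
    |iteratedDeriv k (fun t => Real.sin (a * t + θ) - Real.sin (a * t)) t| ≤ |a| ^ k * |θ| := by
  have hS : ∀ n : ℕ∞, ContDiff ℝ n (fun y => Real.sin (y + θ)) := fun n =>
    Real.contDiff_sin.comp (contDiff_id.add contDiff_const)
  have e := iteratedDeriv_comp_const_mul (n := k) (f := fun y => Real.sin (y + θ) - Real.sin y)
    ((hS k).sub Real.contDiff_sin) a
  rw [e, abs_mul, abs_pow]
  refine mul_le_mul_of_nonneg_left ?_ (by positivity)
  have e2 : iteratedDeriv k (fun y => Real.sin (y + θ) - Real.sin y) (a * t) =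
      iteratedDeriv k Real.sin (a * t + θ) - iteratedDeriv k Real.sin (a * t) := by
    have := iteratedDeriv_sub (n := k) (x := a * t) (hS k).contDiffAt Real.contDiff_sin.contDiffAt
    rw [iteratedDeriv_comp_add_const] at this
    exact this
  rw [e2]
  have := convex_univ.norm_image_sub_le_of_norm_deriv_le (f := iteratedDeriv k Real.sin)
    (x := a * t) (y := a * t + θ) (C := 1)
    (fun x _ => ((Real.contDiff_sin (n := ∞)).differentiable_iteratedDeriv k
      (by exact_mod_cast WithTop.coe_lt_top _)).differentiableAt)
    (fun x _ => by
      rw [← iteratedDeriv_succ]; exact Real.abs_iteratedDeriv_sin_le_one _ _)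
    (mem_univ _) (mem_univ _)
  simpa using this

theorem pow_mul_inv_pow_le {q : ℝ} (hq : 1 ≤ q) {a b : ℕ} (h : a + 1 ≤ b) :
    q ^ a * q⁻¹ ^ b ≤ q⁻¹ := by
  have hq0 : 0 < q := zero_lt_one.trans_le hq
  obtain ⟨c, rfl⟩ := Nat.exists_eq_add_of_le h
  have e : q ^ a * q⁻¹ ^ (a + 1 + c) = (q * q⁻¹) ^ a * q⁻¹ * q⁻¹ ^ c := by
    rw [mul_pow, pow_add, pow_add]; ring
  rw [e, mul_inv_cancel₀ hq0.ne', one_pow, one_mul]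
  exact mul_le_of_le_one_right (by positivity)
    (pow_le_one₀ (by positivity) (inv_le_one_of_one_le₀ hq))

theorem two_pi_le_seven : 2 * Real.pi ≤ 7 := by linarith [Real.pi_lt_d2]

namespace Frequencies

variable (Q : Frequencies)

theorem seven_le_q (m : ℕ) : (7 : ℝ) ≤ Q.q m := by
  linarith [Q.slope_le m 0, abs_nonneg (deriv window 0)]

theorem one_le_q (m : ℕ) : (1 : ℝ) ≤ Q.q m := by linarith [Q.seven_le_q m]

/-- The amplitude of the `m`-th oscillation: small enough for every derivative of the oscillation to
tend to `0` with `m`, but large compared with the speed `amp m ^ 2` of the slow region. -/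
noncomputable def amp (m : ℕ) : ℝ := (Q.q m : ℝ)⁻¹ ^ (m + 3)

theorem amp_pos (m : ℕ) : 0 < Q.amp m := pow_pos (inv_pos.2 (Q.q_pos m)) _

/-- The `m`-th oscillation, of frequency `q m`, cut off to the times at which the reference curve is
in the `m`-th region. -/
noncomputable def osc (m : ℕ) (t : ℝ) : ℝ :=
  Q.amp m * (window (Q.z m * Q.curve t) * Real.sin (2 * Real.pi * Q.q m * t))

/-- The oscillation of the time change. -/
noncomputable def wobble (t : ℝ) : ℝ := ∑' m, Q.osc m t

theorem wobble_eq {m : ℕ} {x u : ℝ} (h : Q.Isolates m x)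
    (hu : Q.curve u ∈ Icc (2 * x / 3) (4 * x / 3)) : Q.wobble u = Q.osc m u := by
  rw [wobble, tsum_eq_single m fun m' hm' => ?_]
  rw [osc, window_eq_zero (h _ hu m' hm')]
  simp

theorem wobble_eventuallyEq {m : ℕ} {x u : ℝ} (h : Q.Isolates m x)
    (hu : Q.curve u ∈ Ioo (2 * x / 3) (4 * x / 3)) : Q.wobble =ᶠ[𝓝 u] Q.osc m := by
  filter_upwards [(Q.contDiff_curve.continuous.continuousAt).eventually (Ioo_mem_nhds hu.1 hu.2)]
    with v hv
  exact Q.wobble_eq h (Ioo_subset_Icc_self hv)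

theorem contDiff_window_curve (m : ℕ) : ContDiff ℝ ∞ fun t => window (Q.z m * Q.curve t) :=
  contDiff_window.comp (contDiff_const.mul Q.contDiff_curve)

theorem contDiff_sin_mul (a : ℝ) : ContDiff ℝ ∞ fun t => Real.sin (a * t) :=
  Real.contDiff_sin.comp (contDiff_const.mul contDiff_id)

theorem contDiff_osc (m : ℕ) : ContDiff ℝ ∞ (Q.osc m) :=
  contDiff_const.mul ((Q.contDiff_window_curve m).mul (contDiff_sin_mul _))

theorem exists_wobble_eventuallyEq (t : ℝ) : ∃ m, Q.wobble =ᶠ[𝓝 t] Q.osc m := by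
  obtain ⟨m, -, hm⟩ := Q.exists_isolates (Q.curve_pos t)
  exact ⟨m, Q.wobble_eventuallyEq hm ⟨by linarith [Q.curve_pos t], by linarith [Q.curve_pos t]⟩⟩

theorem contDiff_wobble : ContDiff ℝ ∞ Q.wobble :=
  contDiff_iff_contDiffAt.2 fun t => by
    obtain ⟨m, hm⟩ := Q.exists_wobble_eventuallyEq t
    exact (Q.contDiff_osc m).contDiffAt.congr_of_eventuallyEq hm

theorem amp_le (m : ℕ) : Q.amp m ≤ (Q.q m : ℝ)⁻¹ ^ 3 :=
  pow_le_pow_of_le_one (inv_nonneg.2 (Q.q_pos m).le) (inv_le_one_of_one_le₀ (Q.one_le_q m))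
    (by omega)

theorem amp_le_one (m : ℕ) : Q.amp m ≤ 1 :=
  pow_le_one₀ (inv_pos.2 (Q.q_pos m)).le (inv_le_one_of_one_le₀ (Q.one_le_q m))

theorem inv_q_le (m : ℕ) : (Q.q m : ℝ)⁻¹ ≤ 1 / 7 := by
  rw [one_div]; exact inv_anti₀ (by norm_num) (Q.seven_le_q m)

theorem abs_wobble_le (t : ℝ) : |Q.wobble t| ≤ 1 / 2 := by
  obtain ⟨m, hm⟩ := Q.exists_wobble_eventuallyEq t
  rw [hm.self_of_nhds, osc, abs_mul, abs_mul, abs_of_pos (Q.amp_pos m),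
    abs_of_nonneg (window_nonneg _)]
  have h1 : (Q.q m : ℝ)⁻¹ ^ 3 ≤ (1 / 7) ^ 3 :=
    pow_le_pow_left₀ (inv_nonneg.2 (Q.q_pos m).le) (Q.inv_q_le m) 3
  have h2 : window (Q.z m * Q.curve t) * |Real.sin (2 * Real.pi * Q.q m * t)| ≤ 1 :=
    mul_le_one₀ (window_le_one _) (abs_nonneg _) (Real.abs_sin_le_one _)
  calc _ ≤ Q.amp m * 1 := mul_le_mul_of_nonneg_left h2 (Q.amp_pos m).le
    _ ≤ 1 / 2 := by linarith [Q.amp_le m]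

theorem abs_deriv_wobble_le (t : ℝ) : |deriv Q.wobble t| ≤ 1 / 2 := by
  obtain ⟨m, hm⟩ := Q.exists_wobble_eventuallyEq t
  rw [hm.deriv_eq]
  have hq := Q.seven_le_q m
  have hw : HasDerivAt (fun t => window (Q.z m * Q.curve t))
      (deriv window (Q.z m * Q.curve t) * (Q.z m * Q.baseField (Q.curve t))) t :=
    ((contDiff_window.differentiable (by simp)).differentiableAt.hasDerivAt).comp t
      ((Q.hasDerivAt_curve t).const_mul _)
  have hs : HasDerivAt (fun t => Real.sin (2 * Real.pi * Q.q m * t))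
      (Real.cos (2 * Real.pi * Q.q m * t) * (2 * Real.pi * Q.q m * 1)) t :=
    (((hasDerivAt_id t).const_mul _).sin)
  have hd : HasDerivAt (Q.osc m) _ t := (hw.mul hs).const_mul (Q.amp m)
  rw [hd.deriv, abs_mul, abs_of_pos (Q.amp_pos m)]
  have b1 : |deriv window (Q.z m * Q.curve t) * (Q.z m * Q.baseField (Q.curve t)) *
      Real.sin (2 * Real.pi * Q.q m * t)| ≤ (Q.q m - 7) * (Q.q m * 1) * 1 := by
    rw [abs_mul, abs_mul, abs_mul, abs_of_pos (Q.z_pos m), Q.abs_baseField]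
    have := Q.slope_le m (Q.z m * Q.curve t)
    have h3 := Q.z_pos m
    have h4 : (0 : ℝ) ≤ Q.q m - 7 := by linarith
    gcongr
    · linarith
    · exact Q.z_le_q m
    · exact (Q.speed_lt_one t).le
    · exact Real.abs_sin_le_one _
  have b2 : |window (Q.z m * Q.curve t) * (Real.cos (2 * Real.pi * Q.q m * t) *
      (2 * Real.pi * Q.q m * 1))| ≤ 1 * (1 * (7 * Q.q m * 1)) := by
    rw [abs_mul, abs_mul, abs_of_nonneg (window_nonneg _), abs_of_pos (a := 2 * Real.pi * _ * 1)
      (by have := Real.pi_pos; positivity)]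
    gcongr
    · exact window_le_one _
    · exact Real.abs_cos_le_one _
    · exact two_pi_le_seven
  have hq0 := Q.q_pos m
  calc _ ≤ (Q.q m : ℝ)⁻¹ ^ 3 * ((Q.q m - 7) * (Q.q m * 1) * 1 + 1 * (1 * (7 * Q.q m * 1))) := by
        refine mul_le_mul (Q.amp_le m) ((abs_add_le _ _).trans (add_le_add b1 b2)) (abs_nonneg _)
          (by positivity)
    _ = (Q.q m : ℝ)⁻¹ := by field_simp; ring
    _ ≤ 1 / 2 := by linarith [Q.inv_q_le m]

/-- The perturbed time coordinate. -/
noncomputable def warp (t : ℝ) : ℝ := t + Q.wobble t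

theorem hasDerivAt_wobble (t : ℝ) : HasDerivAt Q.wobble (deriv Q.wobble t) t :=
  (Q.contDiff_wobble.differentiable (by simp)).differentiableAt.hasDerivAt

theorem hasDerivAt_warp (t : ℝ) : HasDerivAt Q.warp (1 + deriv Q.wobble t) t :=
  (hasDerivAt_id t).add (Q.hasDerivAt_wobble t)

theorem half_le_deriv_warp (t : ℝ) : 1 / 2 ≤ 1 + deriv Q.wobble t := by
  linarith [(abs_le.1 (Q.abs_deriv_wobble_le t)).1]

theorem deriv_warp_le (t : ℝ) : 1 + deriv Q.wobble t ≤ 3 / 2 := by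
  linarith [(abs_le.1 (Q.abs_deriv_wobble_le t)).2]

theorem contDiff_warp : ContDiff ℝ ∞ Q.warp := contDiff_id.add Q.contDiff_wobble

/-- The inverse of `warp`. -/
noncomputable def unwarp : ℝ → ℝ :=
  (exists_inverse_of_deriv_ge (by norm_num : (0 : ℝ) < 1 / 2) Q.hasDerivAt_warp
    Q.half_le_deriv_warp).choose

@[simp] theorem unwarp_warp (t : ℝ) : Q.unwarp (Q.warp t) = t :=
  (exists_inverse_of_deriv_ge (by norm_num : (0 : ℝ) < 1 / 2) Q.hasDerivAt_warp
    Q.half_le_deriv_warp).choose_spec.1 t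

@[simp] theorem warp_unwarp (u : ℝ) : Q.warp (Q.unwarp u) = u :=
  (exists_inverse_of_deriv_ge (by norm_num : (0 : ℝ) < 1 / 2) Q.hasDerivAt_warp
    Q.half_le_deriv_warp).choose_spec.2.1 u

theorem hasDerivAt_unwarp (u : ℝ) :
    HasDerivAt Q.unwarp (1 + deriv Q.wobble (Q.unwarp u))⁻¹ u :=
  (exists_inverse_of_deriv_ge (by norm_num : (0 : ℝ) < 1 / 2) Q.hasDerivAt_warp
    Q.half_le_deriv_warp).choose_spec.2.2 u

theorem abs_warp_sub_le (t : ℝ) : |Q.warp t - t| ≤ 1 := by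
  have := Q.abs_wobble_le t
  simp only [warp, add_sub_cancel_left]; linarith

theorem tendsto_warp : Tendsto Q.warp atTop atTop := by
  refine tendsto_atTop_mono (fun t => ?_) (tendsto_atTop_add_const_right _ (-1 : ℝ) tendsto_id)
  have := (abs_le.1 (Q.abs_warp_sub_le t)).1
  simp only [id]; linarith

theorem tendsto_unwarp : Tendsto Q.unwarp atTop atTop := by
  refine tendsto_atTop_mono (fun u => ?_) (tendsto_atTop_add_const_right _ (-1 : ℝ) tendsto_id)
  have := (abs_le.1 (Q.abs_warp_sub_le (Q.unwarp u))).2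
  rw [Q.warp_unwarp] at this
  simp only [id]; linarith

/-- The derivatives of the `m`-th oscillation at large times are controlled uniformly in `m`. -/
theorem exists_abs_iteratedDeriv_osc_le (k : ℕ) : ∃ C : ℝ, 0 ≤ C ∧ ∀ᶠ t in atTop, ∀ m,
    |iteratedDeriv k (Q.osc m) t| ≤ C * Q.amp m * (Q.q m : ℝ) ^ (2 * k) := by
  obtain ⟨D, hD0, hD⟩ := exists_abs_iteratedDeriv_le_of_support contDiff_window
    (fun y hy => window_eq_zero fun h => hy (Ioo_subset_Icc_self h)) k
  choose E hE0 hE using exists_abs_iterate_fieldDeriv_le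
  obtain ⟨-, C₁, N₁, hC₁, h₁⟩ := Q.polyBounded_baseField k
  have hsmall := (Q.tendsto_curve_inv_pow_mul_speed C₁ N₁).eventually_le_const zero_lt_one
  set K : ℝ := (∑ i ∈ Finset.range (k + 1), E i) * ((k + 1) * D) with hK
  have hK0 : 0 ≤ K := mul_nonneg (Finset.sum_nonneg fun i _ => hE0 i) (by positivity)
  refine ⟨2 ^ k * (K * 7 ^ k), by positivity, ?_⟩
  filter_upwards [Q.tendsto_curve.eventually h₁, hsmall] with t h₁ hsm m
  have hx := Q.curve_pos t
  have hz0 := Q.z_pos m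
  have hz : 1 ≤ Q.z m := by
    have : (0 : ℝ) ≤ m := Nat.cast_nonneg m
    linarith [Q.le_z m]
  have hq := Q.one_le_q m
  have hPs : ContDiff ℝ ∞ fun x => window (Q.z m * x) :=
    contDiff_window.comp (contDiff_const.mul contDiff_id)
  have hw : ∀ i ≤ k, |iteratedDeriv i (fun t => window (Q.z m * Q.curve t)) t| ≤
      K * (Q.q m : ℝ) ^ k := by
    intro i hi
    have e : iteratedDeriv i (fun t => window (Q.z m * Q.curve t)) t =
        ((fieldDeriv Q.baseField)^[i] fun x => window (Q.z m * x)) (Q.curve t) :=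
      iteratedDeriv_comp_eq_iterate_fieldDeriv isOpen_univ (fun u _ => Q.hasDerivAt_curve u)
        (fun u _ => Q.contDiffAt_baseField (Q.curve_pos u)) i _ (fun u _ => hPs.contDiffAt) t
        (mem_univ t)
    rw [e]
    refine (hE i Q.baseField _ (Q.curve t) 1 1 zero_le_one zero_le_one
      (Q.contDiffAt_baseField hx) hPs.contDiffAt (fun j hj => ?_)).trans ?_
    · have := h₁ j (hj.trans hi)
      simp only [one_pow, mul_one]
      exact this.trans hsm
    · have hsum : ∑ j ∈ Finset.range (i + 1), (1 : ℝ) ^ j *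
          |iteratedDeriv j (fun x => window (Q.z m * x)) (Q.curve t)| ≤
          (k + 1) * (D * (Q.q m : ℝ) ^ k) := by
        refine (Finset.sum_le_card_nsmul _ _ (D * (Q.q m : ℝ) ^ k) fun j hj => ?_).trans ?_
        · have hji : j ≤ i := Nat.lt_succ_iff.1 (Finset.mem_range.1 hj)
          rw [one_pow, one_mul, iteratedDeriv_comp_const_mul
            (contDiff_window.of_le (by exact_mod_cast le_top)), abs_mul, abs_pow,
            abs_of_pos hz0, mul_comm]
          gcongr
          · exact hD j (hji.trans hi) _
          · calc Q.z m ^ j ≤ Q.z m ^ k := pow_le_pow_right₀ hz (hji.trans hi)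
              _ ≤ (Q.q m : ℝ) ^ k := pow_le_pow_left₀ hz0.le (Q.z_le_q m) k
        · rw [nsmul_eq_mul, Finset.card_range]
          push_cast
          gcongr
      have hEi : E i ≤ ∑ i ∈ Finset.range (k + 1), E i :=
        Finset.single_le_sum (fun i _ => hE0 i) (Finset.mem_range.2 (by omega))
      calc _ ≤ (∑ i ∈ Finset.range (k + 1), E i) * 1 ^ i * ((k + 1) * (D * (Q.q m : ℝ) ^ k)) := by
            rw [one_pow]
            gcongr
            exact mul_nonneg ((hE0 i).trans hEi) zero_le_one
        _ = _ := by rw [one_pow, hK]; ring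
  have hs : ∀ i ≤ k, |iteratedDeriv i (fun t => Real.sin (2 * Real.pi * Q.q m * t)) t| ≤
      7 ^ k * (Q.q m : ℝ) ^ k := by
    intro i hi
    refine (abs_iteratedDeriv_sin_mul_le _ i t).trans ?_
    rw [abs_of_pos (by have := Q.q_pos m; have := Real.pi_pos; positivity), ← mul_pow]
    calc (2 * Real.pi * Q.q m) ^ i ≤ (7 * Q.q m : ℝ) ^ i := by
          have := Q.q_pos m; have := Real.pi_pos
          gcongr; exact two_pi_le_seven
      _ ≤ (7 * Q.q m : ℝ) ^ k := pow_le_pow_right₀ (by linarith) hi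
  have hprod := abs_iteratedDeriv_mul_le (Q.contDiff_window_curve m).contDiffAt
    (contDiff_sin_mul _).contDiffAt hw hs le_rfl
  have e : iteratedDeriv k (Q.osc m) t = Q.amp m * iteratedDeriv k (fun t =>
      window (Q.z m * Q.curve t) * Real.sin (2 * Real.pi * Q.q m * t)) t :=
    iteratedDeriv_const_mul _ (((Q.contDiff_window_curve m).mul
      (contDiff_sin_mul _)).contDiffAt.of_le (by exact_mod_cast le_top))
  rw [e, abs_mul, abs_of_pos (Q.amp_pos m)]
  calc _ ≤ Q.amp m * (2 ^ k * (K * (Q.q m : ℝ) ^ k * (7 ^ k * (Q.q m : ℝ) ^ k))) :=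
        mul_le_mul_of_nonneg_left hprod (Q.amp_pos m).le
    _ = _ := by rw [two_mul, pow_add]; ring

/-- At large times only the high frequencies are active. -/
theorem eventually_le_index (M : ℕ) :
    ∀ᶠ t in atTop, ∀ m, 3 / 4 ≤ Q.z m * Q.curve t → M ≤ m := by
  have h : Tendsto Q.curve atTop (𝓝 0) := Q.tendsto_curve.mono_right nhdsWithin_le_nhds
  have hz := Q.z_pos M
  filter_upwards [h.eventually_lt_const (u := 3 / 4 / Q.z M) (by positivity)] with t ht m hm
  by_contra! hlt
  have h1 := Q.z_strictMono.monotone hlt.le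
  rw [lt_div_iff₀ hz] at ht
  nlinarith [Q.curve_pos t]

theorem inv_q_le_curve {m : ℕ} {x : ℝ} (h : 3 / 4 ≤ Q.z m * x) (hx : 0 < x) :
    (Q.q m : ℝ)⁻¹ ≤ 2 * x := by
  rw [inv_le_iff_one_le_mul₀ (Q.q_pos m)]
  nlinarith [Q.z_le_q m]

/-- The oscillation tends to `0` with all its derivatives: the exponent `m + 3` of the amplitude
eventually beats the factor `q m ^ (2 * k)` lost by `k` derivatives. -/
theorem tendsto_iteratedDeriv_wobble (k : ℕ) :
    Tendsto (iteratedDeriv k Q.wobble) atTop (𝓝 0) := by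
  obtain ⟨C, hC0, hC⟩ := Q.exists_abs_iteratedDeriv_osc_le k
  have h : Tendsto (fun t => C * (2 * Q.curve t)) atTop (𝓝 (C * (2 * 0))) :=
    ((Q.tendsto_curve.mono_right nhdsWithin_le_nhds).const_mul 2).const_mul C
  rw [mul_zero, mul_zero] at h
  refine squeeze_zero_norm' ?_ h
  filter_upwards [hC, Q.eventually_le_index (2 * k)] with t ht hidx
  have hx := Q.curve_pos t
  obtain ⟨m, hm1, hm2⟩ := Q.exists_isolates hx
  rw [(Q.wobble_eventuallyEq hm2 ⟨by linarith, by linarith⟩).iteratedDeriv_eq, Real.norm_eq_abs]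
  have hmk := hidx m hm1
  calc _ ≤ C * Q.amp m * (Q.q m : ℝ) ^ (2 * k) := ht m
    _ = C * ((Q.q m : ℝ) ^ (2 * k) * (Q.q m : ℝ)⁻¹ ^ (m + 3)) := by rw [amp]; ring
    _ ≤ C * (Q.q m : ℝ)⁻¹ := by
        gcongr; exact pow_mul_inv_pow_le (Q.one_le_q m) (by omega)
    _ ≤ _ := by gcongr; exact Q.inv_q_le_curve hm1 hx

/-! ### Almost periodicity of the time change -/

/-- The time `s` is approximated to high order by fractions whose denominators are the frequencies
`q m`. The exponent `(2 * m + 8) ^ 2` is superlinear in `m`, so as to absorb any fixed power of the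
inverse speed `q m ^ (2 * m + 6)` of the `m`-th slow region. -/
def Resonant (s : ℝ) : Prop :=
  ∃ C : ℝ, 0 ≤ C ∧ ∀ m, ∃ p : ℤ, |Q.q m * s - p| ≤ C * (Q.q m : ℝ)⁻¹ ^ ((2 * m + 8) ^ 2)

/-- The variation of `wobble` over a lapse of time `s`. -/
noncomputable def drift (s t : ℝ) : ℝ := Q.wobble (t + s) - Q.wobble t

theorem contDiff_drift (s : ℝ) : ContDiff ℝ ∞ (Q.drift s) :=
  (Q.contDiff_wobble.comp (contDiff_id.add contDiff_const)).sub Q.contDiff_wobble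

theorem iteratedDeriv_drift (s : ℝ) (k : ℕ) (t : ℝ) : iteratedDeriv k (Q.drift s) t =
    iteratedDeriv k Q.wobble (t + s) - iteratedDeriv k Q.wobble t := by
  have h1 : ContDiffAt ℝ k (fun t => Q.wobble (t + s)) t :=
    ((Q.contDiff_wobble.comp (contDiff_id.add contDiff_const)).of_le
      (by exact_mod_cast le_top)).contDiffAt
  have h2 : ContDiffAt ℝ k Q.wobble t :=
    (Q.contDiff_wobble.of_le (by exact_mod_cast le_top)).contDiffAt
  have := iteratedDeriv_sub h1 h2
  rw [iteratedDeriv_comp_add_const] at this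
  exact this

theorem tendsto_iteratedDeriv_drift (s : ℝ) (k : ℕ) :
    Tendsto (iteratedDeriv k (Q.drift s)) atTop (𝓝 0) := by
  have h1 := (Q.tendsto_iteratedDeriv_wobble k).comp (tendsto_atTop_add_const_right _ s tendsto_id)
  have h2 := h1.sub (Q.tendsto_iteratedDeriv_wobble k)
  rw [sub_zero] at h2
  refine h2.congr fun t => ?_
  rw [Q.iteratedDeriv_drift]; rfl

/-- Away from the slow part of the `m`-th region the base speed is bounded below by a power of
`1 / q m` which does not depend on `m`. -/
theorem exp_expo_le_of_not_mem {m : ℕ} {x y : ℝ} (h : Q.Isolates m x) (hx : 0 < x)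
    (hy : y ∈ Icc (2 * x / 3) (4 * x / 3)) (hz : 1 / 2 ≤ Q.z m * y)
    (hs : Q.z m * y ∉ Ioo (3 : ℝ) 6) : Real.exp (Q.expo y) ≤ (Q.q m : ℝ) ^ 2 := by
  have hy0 : 0 < y := by linarith [hy.1]
  have : Q.expo y ≤ Q.z m + Q.z m := by
    rw [Q.expo_eq h hy, slowBump_eq_zero hs, mul_zero, add_zero, inv_le_iff_one_le_mul₀ hy0]
    linarith
  calc Real.exp (Q.expo y) ≤ Real.exp (Q.z m + Q.z m) := Real.exp_le_exp.2 this
    _ = _ := by rw [Real.exp_add, Q.exp_z, sq]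

theorem exp_level (m : ℕ) : Real.exp (Q.level m) = (Q.q m : ℝ) ^ (2 * m + 6) := by
  rw [← Q.exp_z m, ← Real.exp_nat_mul, level]
  push_cast; ring_nf

/-- On the whole `m`-th region the base speed is bounded below by a power of `1 / q m` which depends
on `m`. -/
theorem exp_expo_le {m : ℕ} {x y : ℝ} (h : Q.Isolates m x) (hx : 0 < x)
    (hy : y ∈ Icc (2 * x / 3) (4 * x / 3)) (hz : 1 / 2 ≤ Q.z m * y) :
    Real.exp (Q.expo y) ≤ (Q.q m : ℝ) ^ (2 * m + 6) := by
  have hy0 : 0 < y := by linarith [hy.1]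
  have h1 : y⁻¹ ≤ Q.level m := by
    rw [inv_le_iff_one_le_mul₀ hy0]
    nlinarith [mul_le_mul_of_nonneg_right (Q.level_ge m) hy0.le]
  rw [← Q.exp_level, Real.exp_le_exp, Q.expo_eq h hy]
  nlinarith [slowBump_le_one (Q.z m * y)]

/-- Over a lapse of time `s` almost resonant with all frequencies, the variation of the oscillation
is negligible with respect to every power of the speed. In the slow part of a region, the speed is a
power of the frequency depending on the region, but the oscillation is exactly periodic, so that its
variation is controlled by the resonance. Elsewhere the speed is at least `q⁻²` and the smallness of
the amplitude suffices. -/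
theorem tendsto_pow_mul_iteratedDeriv_drift {s : ℝ} (hs : Q.Resonant s) (N k : ℕ) :
    Tendsto (fun t => Real.exp (Q.expo (Q.curve (Q.warp t))) ^ N *
      |iteratedDeriv k (Q.drift s) t|) atTop (𝓝 0) := by
  obtain ⟨Cs, hCs0, hCs⟩ := hs
  obtain ⟨C, hC0, hC⟩ := Q.exists_abs_iteratedDeriv_osc_le k
  set K : ℝ := 2 * C + 7 ^ (k + 1) * Cs with hK
  have hK0 : 0 ≤ K := by positivity
  have hlim : Tendsto (fun t => K * (2 * Q.curve t)) atTop (𝓝 (K * (2 * 0))) :=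
    ((Q.tendsto_curve.mono_right nhdsWithin_le_nhds).const_mul 2).const_mul K
  rw [mul_zero, mul_zero] at hlim
  refine squeeze_zero' (Eventually.of_forall fun t => by positivity) ?_ hlim
  have hCs' : ∀ᶠ t in atTop, ∀ m, |iteratedDeriv k (Q.osc m) (t + s)| ≤
      C * Q.amp m * (Q.q m : ℝ) ^ (2 * k) :=
    (tendsto_atTop_add_const_right _ s tendsto_id).eventually hC
  filter_upwards [hC, hCs', Q.eventually_le_index (2 * N + 2 * k + 1),
    Q.eventually_curve_near (|s| + 1)] with t h1 h2 hidx hnear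
  have hx := Q.curve_pos t
  obtain ⟨m, hm1, hm2⟩ := Q.exists_isolates hx
  have hm := hidx m hm1
  have hz0 := Q.z_pos m
  have hq := Q.one_le_q m
  have hq0 := Q.q_pos m
  have hnear' : ∀ u, |u - t| ≤ |s| + 1 → Q.curve u ∈ Ioo (2 * Q.curve t / 3) (4 * Q.curve t / 3) :=
    fun u hu => ⟨by linarith [(hnear u hu).1], by linarith [(hnear u hu).2]⟩
  have ht0 : |t - t| ≤ |s| + 1 := by simp; positivity
  have hts : |t + s - t| ≤ |s| + 1 := by simp
  have hw : |Q.warp t - t| ≤ |s| + 1 := (Q.abs_warp_sub_le t).trans (by linarith [abs_nonneg s])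
  have hzw : 1 / 2 ≤ Q.z m * Q.curve (Q.warp t) := by
    nlinarith [mul_le_mul_of_nonneg_left (hnear _ hw).1 hz0.le]
  suffices Real.exp (Q.expo (Q.curve (Q.warp t))) ^ N * |iteratedDeriv k (Q.drift s) t| ≤
      K * (Q.q m : ℝ)⁻¹ from
    this.trans (by gcongr; exact Q.inv_q_le_curve hm1 hx)
  -- The case is decided at time `t`; the margins in `[5/2, 13/2]` absorb the displacement of the
  -- curve during the bounded times involved.
  by_cases hcase : Q.z m * Q.curve t ∈ Icc (5 / 2 : ℝ) (13 / 2)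
  · have hwin : ∀ u, |u - t| ≤ |s| + 1 → window (Q.z m * Q.curve u) = 1 := fun u hu =>
      window_eq_one ⟨by nlinarith [mul_le_mul_of_nonneg_left (hnear u hu).1 hz0.le, hcase.1],
        by nlinarith [mul_le_mul_of_nonneg_left (hnear u hu).2 hz0.le, hcase.2]⟩
    obtain ⟨p, hp⟩ := hCs m
    set θ : ℝ := 2 * Real.pi * (Q.q m * s - p) with hθ
    have heq : Q.drift s =ᶠ[𝓝 t] fun u => Q.amp m *
        (Real.sin (2 * Real.pi * Q.q m * u + θ) - Real.sin (2 * Real.pi * Q.q m * u)) := by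
      filter_upwards [Metric.ball_mem_nhds t zero_lt_one] with u hu
      have hu1 : |u - t| < 1 := hu
      have hu2 : |u - t| ≤ |s| + 1 := by linarith [abs_nonneg s]
      have hu3 : |u + s - t| ≤ |s| + 1 := by
        calc |u + s - t| = |(u - t) + s| := by ring_nf
          _ ≤ |u - t| + |s| := abs_add_le _ _
          _ ≤ |s| + 1 := by linarith
      rw [drift, Q.wobble_eq hm2 (Ioo_subset_Icc_self (hnear' _ hu3)),
        Q.wobble_eq hm2 (Ioo_subset_Icc_self (hnear' _ hu2)), osc, osc, hwin _ hu3, hwin _ hu2]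
      have : Real.sin (2 * Real.pi * Q.q m * (u + s)) =
          Real.sin (2 * Real.pi * Q.q m * u + θ) := by
        rw [← Real.sin_sub_int_mul_two_pi _ p]; congr 1; rw [hθ]; ring
      rw [this]; ring
    have hpi := Real.pi_pos
    have hd : |iteratedDeriv k (Q.drift s) t| ≤
        Q.amp m * ((7 * Q.q m) ^ k * (7 * (Cs * (Q.q m : ℝ)⁻¹ ^ ((2 * m + 8) ^ 2)))) := by
      have hsm : ContDiff ℝ k (fun u => Real.sin (2 * Real.pi * Q.q m * u + θ) -
          Real.sin (2 * Real.pi * Q.q m * u)) :=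
        (Real.contDiff_sin.comp ((contDiff_const.mul contDiff_id).add contDiff_const)).sub
          (Real.contDiff_sin.comp (contDiff_const.mul contDiff_id))
      rw [heq.iteratedDeriv_eq, iteratedDeriv_const_mul _ hsm.contDiffAt, abs_mul,
        abs_of_pos (Q.amp_pos m)]
      refine mul_le_mul_of_nonneg_left ((abs_iteratedDeriv_sin_sub_le _ _ _ _).trans ?_)
        (Q.amp_pos m).le
      rw [hθ, abs_mul (2 * Real.pi) (Q.q m * s - p),
        abs_of_pos (by positivity : 0 < 2 * Real.pi * Q.q m),
        abs_of_pos (by positivity : 0 < 2 * Real.pi)]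
      have := two_pi_le_seven
      gcongr
    have hE := Q.exp_expo_le hm2 hx (Ioo_subset_Icc_self (hnear' _ hw)) hzw
    have hamp := Q.amp_le_one m
    have hexp : (2 * m + 6) * N + k + 1 ≤ (2 * m + 8) ^ 2 := by
      have : (2 * m + 6) * N ≤ (2 * m + 6) * m := Nat.mul_le_mul_left _ (by omega)
      nlinarith
    calc _ ≤ ((Q.q m : ℝ) ^ (2 * m + 6)) ^ N *
          (1 * ((7 * Q.q m) ^ k * (7 * (Cs * (Q.q m : ℝ)⁻¹ ^ ((2 * m + 8) ^ 2))))) := by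
          gcongr
          exact hd.trans (by gcongr)
      _ = 7 ^ (k + 1) * Cs * ((Q.q m : ℝ) ^ ((2 * m + 6) * N + k) *
          (Q.q m : ℝ)⁻¹ ^ ((2 * m + 8) ^ 2)) := by
          rw [← pow_mul, mul_pow, pow_add (Q.q m : ℝ), pow_succ (7 : ℝ)]; ring
      _ ≤ 7 ^ (k + 1) * Cs * (Q.q m : ℝ)⁻¹ := by
          gcongr; exact pow_mul_inv_pow_le hq hexp
      _ ≤ K * (Q.q m : ℝ)⁻¹ := by
          gcongr; rw [hK]; linarith
  · have hns : Q.z m * Q.curve (Q.warp t) ∉ Ioo (3 : ℝ) 6 := by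
      intro h
      refine hcase ⟨?_, ?_⟩
      · nlinarith [mul_le_mul_of_nonneg_left (hnear _ hw).2 hz0.le, h.1]
      · nlinarith [mul_le_mul_of_nonneg_left (hnear _ hw).1 hz0.le, h.2]
    have hE := Q.exp_expo_le_of_not_mem hm2 hx (Ioo_subset_Icc_self (hnear' _ hw)) hzw hns
    have hd : |iteratedDeriv k (Q.drift s) t| ≤ 2 * (C * Q.amp m * (Q.q m : ℝ) ^ (2 * k)) := by
      rw [Q.iteratedDeriv_drift, (Q.wobble_eventuallyEq hm2 (hnear' _ ht0)).iteratedDeriv_eq,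
        (Q.wobble_eventuallyEq hm2 (hnear' _ hts)).iteratedDeriv_eq]
      exact (abs_sub _ _).trans (by linarith [h1 m, h2 m])
    calc _ ≤ ((Q.q m : ℝ) ^ 2) ^ N * (2 * (C * Q.amp m * (Q.q m : ℝ) ^ (2 * k))) := by gcongr
      _ = 2 * C * ((Q.q m : ℝ) ^ (2 * N + 2 * k) * (Q.q m : ℝ)⁻¹ ^ (m + 3)) := by
          rw [← pow_mul, amp, pow_add (Q.q m : ℝ)]; ring
      _ ≤ 2 * C * (Q.q m : ℝ)⁻¹ := by
          gcongr; exact pow_mul_inv_pow_le hq (by omega)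
      _ ≤ K * (Q.q m : ℝ)⁻¹ := by
          gcongr; rw [hK]; linarith [show (0 : ℝ) ≤ 7 ^ (k + 1) * Cs by positivity]

/-! ### The vector field and its flow -/

/-- The reference integral curve of the perturbed field. -/
noncomputable def orbit (t : ℝ) : ℝ := Q.curve (Q.warp t)

/-- The inverse of `orbit`. -/
noncomputable def clock (x : ℝ) : ℝ := Q.unwarp (Q.time x)

/-- The perturbed vector field: the base field read in the perturbed time coordinate. -/
noncomputable def field (x : ℝ) : ℝ :=
  if 0 < x then Q.baseField x * (1 + deriv Q.wobble (Q.clock x)) else 0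

/-- The flow of `field`, extended by the identity to `(-∞, 0]`. -/
noncomputable def flow (s x : ℝ) : ℝ := if 0 < x then Q.orbit (Q.clock x + s) else x

theorem orbit_pos (t : ℝ) : 0 < Q.orbit t := Q.curve_pos _

@[simp] theorem clock_orbit (t : ℝ) : Q.clock (Q.orbit t) = t := by simp [clock, orbit]

theorem orbit_clock {x : ℝ} (hx : 0 < x) : Q.orbit (Q.clock x) = x := by
  simp [clock, orbit, Q.curve_time hx]

theorem field_orbit (t : ℝ) :
    Q.field (Q.orbit t) = Q.baseField (Q.orbit t) * (1 + deriv Q.wobble t) := by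
  rw [field, if_pos (Q.orbit_pos t), Q.clock_orbit]

theorem field_neg {x : ℝ} (hx : 0 < x) : Q.field x < 0 := by
  rw [field, if_pos hx]
  exact mul_neg_of_neg_of_pos (Q.baseField_neg x) (by linarith [Q.half_le_deriv_warp (Q.clock x)])

theorem hasDerivAt_orbit (t : ℝ) : HasDerivAt Q.orbit (Q.field (Q.orbit t)) t := by
  rw [field_orbit]
  exact (Q.hasDerivAt_curve _).comp t (Q.hasDerivAt_warp t)

theorem deriv_orbit (t : ℝ) : deriv Q.orbit t = Q.field (Q.orbit t) := (Q.hasDerivAt_orbit t).deriv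

theorem hasDerivAt_clock {x : ℝ} (hx : 0 < x) : HasDerivAt Q.clock (Q.field x)⁻¹ x := by
  have := (Q.hasDerivAt_unwarp (Q.time x)).comp x (Q.hasDerivAt_time hx)
  refine this.congr_deriv ?_
  rw [field, if_pos hx, mul_inv, clock]; ring

theorem contDiff_orbit : ContDiff ℝ ∞ Q.orbit := Q.contDiff_curve.comp Q.contDiff_warp

theorem contDiff_deriv_orbit : ContDiff ℝ ∞ (deriv Q.orbit) :=
  (contDiff_infty_iff_deriv.1 Q.contDiff_orbit).2

theorem continuousOn_clock : ContinuousOn Q.clock (Ioi 0) := fun _ hx =>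
  (Q.hasDerivAt_clock hx).continuousAt.continuousWithinAt

theorem field_eq {x : ℝ} (hx : 0 < x) : Q.field x = deriv Q.orbit (Q.clock x) := by
  rw [Q.deriv_orbit, Q.orbit_clock hx]

theorem deriv_orbit_ne_zero (t : ℝ) : deriv Q.orbit t ≠ 0 := by
  rw [Q.deriv_orbit]; exact (Q.field_neg (Q.orbit_pos t)).ne

theorem contDiffOn_clock : ContDiffOn ℝ ∞ Q.clock (Ioi 0) := by
  refine contDiffOn_infty.2 fun n => ?_
  induction n with
  | zero => exact contDiffOn_zero.2 Q.continuousOn_clock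
  | succ n ih =>
    rw [Nat.cast_add, Nat.cast_one, contDiffOn_succ_iff_deriv_of_isOpen isOpen_Ioi]
    refine ⟨fun x hx => (Q.hasDerivAt_clock hx).differentiableAt.differentiableWithinAt,
      fun h => by simp at h, ?_⟩
    have : ContDiffOn ℝ n (fun x => (deriv Q.orbit (Q.clock x))⁻¹) (Ioi 0) :=
      ((Q.contDiff_deriv_orbit.of_le (by exact_mod_cast le_top)).comp_contDiffOn ih).inv
        fun x _ => Q.deriv_orbit_ne_zero _
    refine this.congr fun x hx => ?_
    rw [(Q.hasDerivAt_clock hx).deriv, Q.field_eq hx]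

theorem tendsto_clock : Tendsto Q.clock (𝓝[>] 0) atTop := Q.tendsto_unwarp.comp Q.tendsto_time

theorem contDiffOn_field_Ioi : ContDiffOn ℝ ∞ Q.field (Ioi 0) :=
  (Q.contDiff_deriv_orbit.comp_contDiffOn Q.contDiffOn_clock).congr fun _ hx => Q.field_eq hx

theorem isContracting_field : IsContracting Q.field :=
  ⟨by simp [field], fun _ hx => Q.field_neg hx⟩

theorem isCompleteFlow_flow : IsCompleteFlow Q.field Q.flow := by
  intro x hx
  rcases hx.eq_or_lt with rfl | hx
  · refine ⟨by simp [flow], fun t => by simp [flow], fun t => ?_⟩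
    simpa [flow, field] using hasDerivAt_const t (0 : ℝ)
  · refine ⟨by simp [flow, hx, Q.orbit_clock hx],
      fun t => by simpa [flow, hx] using (Q.orbit_pos _).le, fun t => ?_⟩
    simp only [flow, hx, if_true]
    exact (Q.hasDerivAt_orbit (Q.clock x + t)).comp_const_add (Q.clock x) t

/-- The quotient of the first two time derivatives of the orbit, which is the space derivative of
the field along the orbit. -/
theorem deriv_deriv_orbit_div (t : ℝ) : (deriv Q.orbit t)⁻¹ * deriv (deriv Q.orbit) t =
    deriv Q.baseField (Q.orbit t) * (1 + deriv Q.wobble t) +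
      deriv (deriv Q.wobble) t / (1 + deriv Q.wobble t) := by
  have hb : HasDerivAt (fun t => Q.baseField (Q.orbit t))
      (deriv Q.baseField (Q.orbit t) * Q.field (Q.orbit t)) t :=
    ((Q.contDiffAt_baseField (Q.orbit_pos t)).differentiableAt (by simp)).hasDerivAt.comp t
      (Q.hasDerivAt_orbit t)
  have hw : HasDerivAt (fun t => 1 + deriv Q.wobble t) (deriv (deriv Q.wobble) t) t :=
    (((contDiff_infty_iff_deriv.1 Q.contDiff_wobble).2.differentiable
      (by simp)).differentiableAt.hasDerivAt).const_add 1
  have e : deriv Q.orbit = fun t => Q.baseField (Q.orbit t) * (1 + deriv Q.wobble t) := by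
    funext u; rw [Q.deriv_orbit, Q.field_orbit]
  have h1 := (Q.baseField_neg (Q.orbit t)).ne
  have h2 : 1 + deriv Q.wobble t ≠ 0 := by linarith [Q.half_le_deriv_warp t]
  have h3 := (hb.mul hw).deriv
  rw [e, show deriv (fun t => Q.baseField (Q.orbit t) * (1 + deriv Q.wobble t)) t = _ from h3,
    Q.field_orbit]
  field_simp

theorem hasDerivAt_field {x : ℝ} (hx : 0 < x) : HasDerivAt Q.field
    (deriv (deriv Q.orbit) (Q.clock x) * (Q.field x)⁻¹) x := by
  have h := ((Q.contDiff_deriv_orbit.differentiable (by simp)).differentiableAt.hasDerivAt).comp x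
    (Q.hasDerivAt_clock hx)
  refine h.congr_of_eventuallyEq ?_
  filter_upwards [Ioi_mem_nhds hx] with y hy
  exact Q.field_eq hy

/-- The field is of class `C¹` because the second derivative of the time change tends to `0`. -/
theorem contDiff_one_field : ContDiff ℝ 1 Q.field := by
  refine contDiff_nat_of_flat (n := 1) (fun x hx => if_neg (not_lt.2 hx))
    (Q.contDiffOn_field_Ioi.of_le (by exact_mod_cast le_top)) fun k hk => ?_
  have hbase : ∀ k, Tendsto (iteratedDeriv k Q.baseField) (𝓝[>] 0) (𝓝 0) := by
    intro k
    obtain ⟨-, C, N, hC, h⟩ := Q.polyBounded_baseField k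
    refine squeeze_zero_norm' ?_ (Q.tendsto_inv_pow_mul_exp_neg_expo C N)
    filter_upwards [h] with x hx using hx k le_rfl
  have hpos : ∀ᶠ x : ℝ in 𝓝[>] 0, 0 < x := self_mem_nhdsWithin
  have hw : ∀ t, |1 + deriv Q.wobble t| ≤ 3 / 2 := fun t =>
    abs_le.2 ⟨by linarith [Q.half_le_deriv_warp t], Q.deriv_warp_le t⟩
  have hmul : ∀ k, Tendsto (fun x => iteratedDeriv k Q.baseField x *
      (1 + deriv Q.wobble (Q.clock x))) (𝓝[>] 0) (𝓝 0) := by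
    intro k
    have := (hbase k).norm.mul_const (3 / 2 : ℝ)
    rw [norm_zero, zero_mul] at this
    refine squeeze_zero_norm (fun x => ?_) this
    rw [norm_mul]
    exact mul_le_mul_of_nonneg_left (hw _) (norm_nonneg _)
  interval_cases k
  · rw [iteratedDeriv_zero]
    refine (hmul 0).congr' ?_
    filter_upwards [hpos] with x hx
    rw [iteratedDeriv_zero, field, if_pos hx]
  · rw [iteratedDeriv_one]
    have h2 : Tendsto (fun t => deriv (deriv Q.wobble) t / (1 + deriv Q.wobble t))
        atTop (𝓝 0) := by
      have h3 := Q.tendsto_iteratedDeriv_wobble 2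
      rw [iteratedDeriv_succ, iteratedDeriv_one] at h3
      have := h3.norm.mul_const (2 : ℝ)
      rw [norm_zero, zero_mul] at this
      refine squeeze_zero_norm (fun t => ?_) this
      rw [norm_div, div_eq_mul_inv]
      refine mul_le_mul_of_nonneg_left ?_ (norm_nonneg _)
      have h4 := Q.half_le_deriv_warp t
      rw [Real.norm_eq_abs, abs_of_pos (by linarith), inv_le_comm₀ (by linarith) (by norm_num)]
      linarith
    have h5 := (hmul 1).add (h2.comp Q.tendsto_clock)
    rw [add_zero] at h5
    refine h5.congr' ?_
    filter_upwards [hpos] with x hx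
    rw [(Q.hasDerivAt_field hx).deriv, mul_comm (deriv (deriv Q.orbit) _), Q.field_eq hx,
      Q.deriv_deriv_orbit_div, Q.orbit_clock hx, iteratedDeriv_one]
    rfl

/-! ### Smoothness of the flow at resonant times -/

theorem polyBounded_deriv_warp (n : ℕ) : PolyBounded atTop 1 1 n (deriv Q.warp) := by
  have h := PolyBounded.add (Eventually.of_forall fun _ => le_rfl)
    (Eventually.of_forall fun _ => zero_le_one) (PolyBounded.const (l := atTop) (W := 1) (n := n) 1)
    (PolyBounded.of_tendsto Q.contDiff_wobble Q.tendsto_iteratedDeriv_wobble (n + 1)).deriv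
  refine h.congr (Eventually.of_forall fun t => Eventually.of_forall fun u => ?_)
  exact (Q.hasDerivAt_warp u).deriv.symm

theorem polyBounded_orbit (n : ℕ) : PolyBounded atTop 1 1 n Q.orbit :=
  PolyBounded.comp_of_bounded Q.tendsto_warp
    (Eventually.of_forall fun _ => Q.contDiff_warp.contDiffAt)
    Q.polyBounded_deriv_warp Q.polyBounded_curve n

/-- A gauge dominating `1` and the inverse of the speed of the perturbed flow. -/
noncomputable def slowness (t : ℝ) : ℝ := 1 + |(deriv Q.orbit t)⁻¹|

theorem one_le_slowness (t : ℝ) : 1 ≤ Q.slowness t := le_add_of_nonneg_right (abs_nonneg _)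

theorem slowness_le (t : ℝ) : Q.slowness t ≤ 3 * Real.exp (Q.expo (Q.curve (Q.warp t))) := by
  have h1 : 1 ≤ Real.exp (Q.expo (Q.orbit t)) := Real.one_le_exp
    ((inv_pos.2 (Q.orbit_pos t)).le.trans (Q.inv_le_expo (Q.orbit_pos t)))
  have h2 := Q.half_le_deriv_warp t
  have h3 : |(deriv Q.orbit t)⁻¹| ≤ Real.exp (Q.expo (Q.orbit t)) * 2 := by
    rw [Q.deriv_orbit, Q.field_orbit, mul_inv, abs_mul, abs_inv, Q.abs_baseField, Real.exp_neg,
      inv_inv, abs_inv, abs_of_pos (by linarith : 0 < 1 + deriv Q.wobble t)]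
    refine mul_le_mul_of_nonneg_left ?_ (Real.exp_pos _).le
    rw [inv_le_comm₀ (by linarith) (by norm_num)]
    linarith
  change 1 + |(deriv Q.orbit t)⁻¹| ≤ 3 * Real.exp (Q.expo (Q.orbit t))
  linarith

theorem polyBounded_inv_deriv_orbit (n : ℕ) :
    PolyBounded atTop Q.slowness 1 n fun t => (deriv Q.orbit t)⁻¹ := by
  refine PolyBounded.inv (Eventually.of_forall Q.one_le_slowness) (fun n => ?_)
    (Eventually.of_forall fun t => Eventually.of_forall fun u => Q.deriv_orbit_ne_zero u)
    (Eventually.of_forall fun t => by simp [slowness]) n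
  obtain ⟨h1, C, N, hC, h2⟩ := (Q.polyBounded_orbit (n + 1)).deriv
  exact ⟨h1, C, 0, hC, by simpa using h2⟩

/-- The displacement in space caused by `drift` along the base flow is flat at the origin. -/
theorem tendsto_iterate_fieldDeriv_curve_drift {s : ℝ} (hs : Q.Resonant s) (k : ℕ) :
    Tendsto ((fieldDeriv fun t => (deriv Q.orbit t)⁻¹)^[k]
      fun t => Q.curve (Q.warp t + Q.drift s t) - Q.curve (Q.warp t)) atTop (𝓝 0) := by
  set M : ℝ → ℝ := fun t => ∑ j ∈ Finset.range (k + 1), |iteratedDeriv j (Q.drift s) t| with hM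
  have hM0 : ∀ t, 0 ≤ M t := fun t => Finset.sum_nonneg fun j _ => abs_nonneg _
  have hDM : PolyBounded atTop 1 M k (Q.drift s) := by
    refine ⟨Eventually.of_forall fun t => (Q.contDiff_drift s).contDiffAt, 1, 0, zero_le_one,
      Eventually.of_forall fun t i hi => ?_⟩
    rw [pow_zero, one_mul, one_mul]
    exact Finset.single_le_sum (f := fun j => |iteratedDeriv j (Q.drift s) t|)
      (fun j _ => abs_nonneg _) (Finset.mem_range.2 (by omega))
  have hD0 : ∀ᶠ t in atTop, |Q.drift s t| ≤ 1 := by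
    have := (Q.tendsto_iteratedDeriv_drift s 0).abs.eventually_le_const
      (show |(0 : ℝ)| < 1 by simp)
    simpa using this
  have hΦ := PolyBounded.comp_add_sub Q.contDiff_curve Q.polyBounded_curve Q.contDiff_warp
    Q.tendsto_warp Q.polyBounded_deriv_warp (Q.contDiff_drift s) hD0
    (fun n => (PolyBounded.of_tendsto (Q.contDiff_drift s)
      (Q.tendsto_iteratedDeriv_drift s) (n + 1)).deriv) hDM (Eventually.of_forall hM0)
  obtain ⟨hΦs, C₁, N₁, hC₁, h₁⟩ := hΦ
  obtain ⟨hgs, C₂, N₂, hC₂, h₂⟩ := Q.polyBounded_inv_deriv_orbit k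
  obtain ⟨C₀, hC₀, hop⟩ := exists_abs_iterate_fieldDeriv_le k
  have hlim : Tendsto (fun t => C₀ * C₂ ^ k * (3 ^ (N₂ * k) * ((k + 1) * C₁)) *
      (Real.exp (Q.expo (Q.curve (Q.warp t))) ^ (N₂ * k) * M t)) atTop (𝓝 0) := by
    have h3 : Tendsto (fun t => ∑ j ∈ Finset.range (k + 1),
        Real.exp (Q.expo (Q.curve (Q.warp t))) ^ (N₂ * k) * |iteratedDeriv j (Q.drift s) t|)
        atTop (𝓝 (∑ j ∈ Finset.range (k + 1), (0 : ℝ))) :=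
      tendsto_finsetSum _ fun j _ => Q.tendsto_pow_mul_iteratedDeriv_drift hs _ j
    rw [Finset.sum_const_zero] at h3
    have h4 := h3.const_mul (C₀ * C₂ ^ k * (3 ^ (N₂ * k) * ((k + 1) * C₁)))
    rw [mul_zero] at h4
    refine h4.congr fun t => ?_
    rw [show Real.exp (Q.expo (Q.curve (Q.warp t))) ^ (N₂ * k) * M t = _ from Finset.mul_sum ..]
  refine squeeze_zero_norm' ?_ hlim
  filter_upwards [hΦs, hgs, h₁, h₂] with t hΦt hgt h₁ h₂
  have hsl : 0 ≤ Q.slowness t := zero_le_one.trans (Q.one_le_slowness t)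
  refine (hop _ _ t (C₂ * Q.slowness t ^ N₂) 1 (by positivity) zero_le_one hgt hΦt
    (fun i hi => by simpa using h₂ i hi)).trans ?_
  have hsum : ∑ j ∈ Finset.range (k + 1), (1 : ℝ) ^ j * |iteratedDeriv j (fun t =>
      Q.curve (Q.warp t + Q.drift s t) - Q.curve (Q.warp t)) t| ≤ (k + 1) * (C₁ * M t) := by
    refine (Finset.sum_le_card_nsmul _ _ (C₁ * M t) fun j hj => ?_).trans (by simp)
    simpa using h₁ j (Nat.lt_succ_iff.1 (Finset.mem_range.1 hj))
  have hM0' := hM0 t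
  calc _ ≤ C₀ * (C₂ * (3 * Real.exp (Q.expo (Q.curve (Q.warp t)))) ^ N₂) ^ k *
        ((k + 1) * (C₁ * M t)) := by
        refine mul_le_mul ?_ hsum (Finset.sum_nonneg fun j _ => by positivity) (by positivity)
        gcongr
        exact Q.slowness_le t
    _ = _ := by rw [mul_pow C₂, ← pow_mul, mul_pow (3 : ℝ)]; ring

/-- The space map `x ↦ ψ^{drift}(x)`, where `ψ` is the base flow; it measures by how much the
time-`s` map of the perturbed flow differs from that of the base flow. -/
noncomputable def driftMap (s x : ℝ) : ℝ :=
  if 0 < x then Q.curve (Q.time x + Q.drift s (Q.clock x)) else x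

theorem contDiff_driftMap {s : ℝ} (hs : Q.Resonant s) : ContDiff ℝ ∞ (Q.driftMap s) := by
  set r : ℝ → ℝ := fun x =>
    if 0 < x then Q.curve (Q.time x + Q.drift s (Q.clock x)) - x else 0 with hr
  have hEq : ∀ x ∈ Ioi (0 : ℝ), r x = Q.curve (Q.time x + Q.drift s (Q.clock x)) - x :=
    fun x hx => if_pos hx
  have hrc : ContDiff ℝ ∞ r := by
    refine contDiff_infty_of_flat (fun x hx => if_neg (not_lt.2 hx)) ?_ fun k => ?_
    · refine ContDiffOn.congr ?_ hEq
      exact (Q.contDiff_curve.comp_contDiffOn (Q.contDiffOn_time.add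
        ((Q.contDiff_drift s).comp_contDiffOn Q.contDiffOn_clock))).sub contDiffOn_id
    · refine ((Q.tendsto_iterate_fieldDeriv_curve_drift hs k).comp Q.tendsto_clock).congr' ?_
      filter_upwards [self_mem_nhdsWithin] with x hx
      have hx : 0 < x := hx
      rw [Function.comp_apply,
        ← iteratedDeriv_comp_eq_iterate_fieldDeriv (τ := Q.clock) isOpen_Ioi ?_ ?_ k _ ?_ x hx]
      · apply Filter.EventuallyEq.iteratedDeriv_eq
        filter_upwards [Ioi_mem_nhds hx] with y hy
        rw [hEq y hy, Function.comp_apply, clock, Q.warp_unwarp, Q.curve_time hy]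
      · intro y hy
        have := Q.hasDerivAt_clock hy
        rwa [Q.field_eq hy] at this
      · intro y _
        exact Q.contDiff_deriv_orbit.contDiffAt.inv (Q.deriv_orbit_ne_zero _)
      · intro y _
        exact ((Q.contDiff_curve.comp (Q.contDiff_warp.add (Q.contDiff_drift s))).sub
          (Q.contDiff_curve.comp Q.contDiff_warp)).contDiffAt
  have : Q.driftMap s = fun x => x + r x := by
    funext x
    simp only [driftMap, hr]
    split_ifs <;> ring
  rw [this]
  exact contDiff_id.add hrc

theorem flow_eq_comp (s : ℝ) : Q.flow s = Q.baseMap s ∘ Q.driftMap s := by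
  funext x
  by_cases hx : 0 < x
  · have h : Q.time x = Q.clock x + Q.wobble (Q.clock x) := (Q.warp_unwarp (Q.time x)).symm
    simp only [flow, driftMap, Function.comp, hx, if_true, baseMap, Q.curve_pos, Q.time_curve,
      orbit, warp]
    congr 1
    rw [h, drift]; ring
  · simp [flow, driftMap, baseMap, hx]

/-- At resonant times the flow is smooth. -/
theorem contDiff_flow {s : ℝ} (hs : Q.Resonant s) : ContDiff ℝ ∞ (Q.flow s) := by
  rw [flow_eq_comp]
  exact (Q.contDiff_baseMap s).comp (Q.contDiff_driftMap hs)

/-! ### Failure of `C²` regularity -/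

/-- The `m`-th slow region is centred at `9 / 2 / z m`, where no other region is active. -/
theorem isolates_slow (m : ℕ) : Q.Isolates m (9 / 2 / Q.z m) := by
  have hz := Q.z_pos m
  have hx : 0 < 9 / 2 / Q.z m := by positivity
  obtain ⟨m', h1, h2⟩ := Q.exists_isolates hx
  rcases eq_or_ne m m' with rfl | hne
  · exact h2
  · refine absurd ?_ (h2 _ (Isolates.self_mem hx) m hne)
    rw [mul_div_cancel₀ _ hz.ne']
    norm_num

theorem mem_of_slow {m : ℕ} {x : ℝ} (h : Q.z m * x ∈ Icc (4 : ℝ) 5) :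
    x ∈ Ioo (2 * (9 / 2 / Q.z m) / 3) (4 * (9 / 2 / Q.z m) / 3) := by
  have hz := Q.z_pos m
  have e : x = Q.z m * x / Q.z m := by field_simp
  obtain ⟨h1, h2⟩ := h
  have e1 : 2 * (9 / 2 / Q.z m) / 3 = 3 / Q.z m := by ring
  have e2 : 4 * (9 / 2 / Q.z m) / 3 = 6 / Q.z m := by ring
  rw [e1, e2, e]
  constructor <;> gcongr <;> linarith

/-- In the `m`-th slow region the base field is constant, so the base flow is a translation. -/
theorem baseField_slow {m : ℕ} {x : ℝ} (h : Q.z m * x ∈ Icc (4 : ℝ) 5) :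
    Q.baseField x = -Q.amp m ^ 2 := by
  rw [baseField, Q.expo_eq (Q.isolates_slow m) (Ioo_subset_Icc_self (Q.mem_of_slow h)),
    slowBump_eq_one h, mul_one, add_sub_cancel, Real.exp_neg, Q.exp_level, amp, ← pow_mul, inv_pow]
  congr 3
  ring

/-- The base flow takes a long time to cross the `m`-th slow region. -/
theorem exists_slow_interval (m : ℕ) : ∃ p : ℤ, ∀ u ∈ Icc (p - 3 : ℝ) (p + 4),
    Q.z m * Q.curve u ∈ Icc (4 : ℝ) 5 := by
  have hz := Q.z_pos m
  have h5 : 0 < 5 / Q.z m := by positivity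
  have h4 : 0 < 4 / Q.z m := by positivity
  set u₀ := Q.time (5 / Q.z m) with hu₀
  set u₁ := Q.time (4 / Q.z m) with hu₁
  have e₀ : Q.curve u₀ = 5 / Q.z m := Q.curve_time h5
  have e₁ : Q.curve u₁ = 4 / Q.z m := Q.curve_time h4
  have hzone : ∀ u ∈ Icc u₀ u₁, Q.z m * Q.curve u ∈ Icc (4 : ℝ) 5 := by
    intro u hu
    have i₀ := Q.curve_strictAnti.antitone hu.1
    have i₁ := Q.curve_strictAnti.antitone hu.2
    rw [e₀, le_div_iff₀ hz] at i₀
    rw [e₁, div_le_iff₀ hz] at i₁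
    constructor <;> linarith
  have h01 : u₀ ≤ u₁ := by
    by_contra! h
    have := Q.curve_strictAnti h
    rw [e₀, e₁, div_lt_div_iff_of_pos_right hz] at this
    norm_num at this
  have hmv := (convex_Icc u₀ u₁).norm_image_sub_le_of_norm_hasDerivWithin_le
    (f := Q.curve) (C := Q.amp m ^ 2) (fun u _ => (Q.hasDerivAt_curve u).hasDerivWithinAt)
    (fun u hu => by
      rw [Q.baseField_slow (hzone u hu), norm_neg, Real.norm_of_nonneg (sq_nonneg _)])
    (left_mem_Icc.2 h01) (right_mem_Icc.2 h01)
  rw [e₀, e₁, Real.norm_eq_abs, Real.norm_of_nonneg (by linarith : 0 ≤ u₁ - u₀)] at hmv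
  have hκ : Q.z m * (Q.amp m ^ 2 * 8) ≤ 1 := by
    have h1 : Q.amp m ^ 2 ≤ (Q.q m : ℝ)⁻¹ ^ 3 := by
      refine le_trans ?_ (Q.amp_le m)
      rw [sq]
      exact mul_le_of_le_one_left (Q.amp_pos m).le (Q.amp_le_one m)
    have hq := Q.q_pos m
    calc Q.z m * (Q.amp m ^ 2 * 8) ≤ Q.q m * ((Q.q m : ℝ)⁻¹ ^ 3 * 8) := by
          gcongr
          exact Q.z_le_q m
      _ = 8 * (Q.q m : ℝ)⁻¹ ^ 2 := by field_simp
      _ ≤ 8 * (1 / 7) ^ 2 := by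
          have := Q.inv_q_le m
          gcongr
      _ ≤ 1 := by norm_num
  have hlen : 8 ≤ u₁ - u₀ := by
    have hA : 0 < Q.amp m ^ 2 := pow_pos (Q.amp_pos m) 2
    have h1 : 1 / Q.z m ≤ Q.amp m ^ 2 * (u₁ - u₀) := by
      refine le_trans ?_ hmv
      rw [abs_sub_comm]
      refine le_trans (le_of_eq ?_) (le_abs_self _)
      ring
    rw [div_le_iff₀ hz] at h1
    have h2 : Q.amp m ^ 2 * Q.z m * 8 ≤ Q.amp m ^ 2 * Q.z m * (u₁ - u₀) := by linarith
    exact le_of_mul_le_mul_left h2 (by positivity)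
  refine ⟨⌈u₀⌉ + 3, fun u hu => hzone u ?_⟩
  have c1 := Int.le_ceil u₀
  have c2 := (Int.ceil_lt_add_one u₀).le
  obtain ⟨b1, b2⟩ := hu
  push_cast at b1 b2
  exact ⟨by linarith, by linarith⟩

/-- The relative amplitude of the oscillation of the speed in the `m`-th slow region. -/
noncomputable def ripple (m : ℕ) : ℝ := Q.amp m * (2 * Real.pi * Q.q m)

theorem ripple_pos (m : ℕ) : 0 < Q.ripple m :=
  mul_pos (Q.amp_pos m) (mul_pos Real.two_pi_pos (Q.q_pos m))

theorem ripple_lt_one (m : ℕ) : Q.ripple m < 1 := by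
  have hq := Q.q_pos m
  calc Q.ripple m ≤ (Q.q m : ℝ)⁻¹ ^ 3 * (7 * Q.q m) := by
        rw [ripple]
        have := Q.amp_le m
        have := two_pi_le_seven
        gcongr
    _ = 7 * (Q.q m : ℝ)⁻¹ ^ 2 := by field_simp
    _ ≤ 7 * (1 / 7) ^ 2 := by
        have := Q.inv_q_le m
        gcongr
    _ < 1 := by norm_num

/-- Around a suitable integer time the perturbed orbit stays in the `m`-th slow region, where its
speed is an explicit trigonometric function of time. -/
theorem exists_deriv_orbit_eq (m : ℕ) : ∃ p : ℤ, ∀ t ∈ Icc (p - 2 : ℝ) (p + 3),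
    Q.orbit t ∈ Ioc 0 1 ∧
      deriv Q.orbit t = -Q.amp m ^ 2 * (1 + Q.ripple m * Real.cos (2 * Real.pi * Q.q m * t)) := by
  obtain ⟨p, hp⟩ := Q.exists_slow_interval m
  refine ⟨p, fun t ht => ?_⟩
  obtain ⟨h1, h2⟩ := abs_le.1 (Q.abs_warp_sub_le t)
  have hslow : Q.z m * Q.orbit t ∈ Icc (4 : ℝ) 5 :=
    hp _ ⟨by linarith [ht.1], by linarith [ht.2]⟩
  refine ⟨⟨Q.orbit_pos t, ?_⟩, ?_⟩
  · have hz : 10 ≤ Q.z m := by linarith [Q.le_z m, (Nat.cast_nonneg m : (0 : ℝ) ≤ m)]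
    nlinarith [hslow.2, Q.orbit_pos t]
  have hw : Q.wobble =ᶠ[𝓝 t] fun t => Q.amp m * Real.sin (2 * Real.pi * Q.q m * t) := by
    filter_upwards [Ioo_mem_nhds (show (p - 3 : ℝ) < t by linarith [ht.1])
      (show t < (p + 4 : ℝ) by linarith [ht.2])] with u hu
    have hu' := hp u (Ioo_subset_Icc_self hu)
    rw [Q.wobble_eq (Q.isolates_slow m) (Ioo_subset_Icc_self (Q.mem_of_slow hu')), osc,
      window_eq_one ⟨by linarith [hu'.1], by linarith [hu'.2]⟩, one_mul]
  have hd : HasDerivAt (fun t => Q.amp m * Real.sin (2 * Real.pi * Q.q m * t))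
      (Q.amp m * (Real.cos (2 * Real.pi * Q.q m * t) * (2 * Real.pi * Q.q m))) t := by
    simpa using ((((hasDerivAt_id t).const_mul (2 * Real.pi * Q.q m)).sin).const_mul (Q.amp m))
  rw [Q.deriv_orbit, Q.field_orbit, Q.baseField_slow hslow, hw.deriv_eq, hd.deriv, ripple]
  ring

theorem abs_orbit_sub_le {m : ℕ} {p : ℤ} (hp : ∀ t ∈ Icc (p - 2 : ℝ) (p + 3),
      deriv Q.orbit t = -Q.amp m ^ 2 * (1 + Q.ripple m * Real.cos (2 * Real.pi * Q.q m * t)))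
    {t u : ℝ} (ht : t ∈ Icc (p - 2 : ℝ) (p + 3)) (hu : u ∈ Icc (p - 2 : ℝ) (p + 3)) :
    |Q.orbit u - Q.orbit t| ≤ Q.amp m ^ 2 * 2 * |u - t| := by
  refine (convex_Icc (p - 2 : ℝ) (p + 3)).norm_image_sub_le_of_norm_deriv_le (f := Q.orbit)
    (fun v _ => (Q.hasDerivAt_orbit v).differentiableAt) (fun v hv => ?_) ht hu
  rw [hp v hv, norm_mul, norm_neg, Real.norm_of_nonneg (sq_nonneg _)]
  gcongr
  refine (norm_add_le _ _).trans ?_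
  rw [norm_one, norm_mul, Real.norm_of_nonneg (Q.ripple_pos m).le]
  have := mul_le_mul (Q.ripple_lt_one m).le (Real.abs_cos_le_one (2 * Real.pi * Q.q m * v))
    (abs_nonneg _) zero_le_one
  rw [Real.norm_eq_abs]
  linarith

theorem exists_lt_q (K : ℝ) : ∃ m, K < Q.q m := by
  obtain ⟨m, hm⟩ := exists_nat_gt K
  refine ⟨m, hm.trans_le ?_⟩
  linarith [Q.le_z m, Q.z_le_q m]

theorem cos_two_pi_mul_int (m : ℕ) (p : ℤ) (y : ℝ) :
    Real.cos (2 * Real.pi * Q.q m * (p + y)) = Real.cos (2 * Real.pi * Q.q m * y) := by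
  rw [← Real.cos_add_int_mul_two_pi (2 * Real.pi * Q.q m * y) (Q.q m * p)]
  congr 1
  push_cast
  ring

/-- The times `s` which stay quantitatively away from the resonances of the oscillations. -/
def NonResonant (s : ℝ) : Prop :=
  s ∈ Icc 0 1 ∧ ∀ m, 2 * (Q.q m : ℝ)⁻¹ ^ 2 ≤ 1 - Real.cos (2 * Real.pi * Q.q m * s)

theorem hasDerivAt_flow (s t : ℝ) :
    HasDerivAt (Q.flow s) (deriv Q.orbit (t + s) * (deriv Q.orbit t)⁻¹) (Q.orbit t) := by
  have h1 := Q.hasDerivAt_clock (Q.orbit_pos t)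
  rw [← Q.deriv_orbit] at h1
  have h2 : HasDerivAt (fun v => Q.orbit (v + s)) (deriv Q.orbit (t + s))
      (Q.clock (Q.orbit t)) := by
    rw [Q.clock_orbit, Q.deriv_orbit]
    exact (Q.hasDerivAt_orbit (t + s)).comp_add_const t s
  refine (h2.comp _ h1).congr_of_eventuallyEq ?_
  filter_upwards [Ioi_mem_nhds (Q.orbit_pos t)] with y hy
  exact if_pos hy

/-- At a non-resonant time the derivative of the flow oscillates by about `ripple m` on an interval
of length about `amp m ^ 2`, so that it is not Lipschitz near the origin. -/
theorem not_contDiffOn_flow {s : ℝ} (hs : Q.NonResonant s) :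
    ¬ ContDiffOn ℝ 2 (Q.flow s) (Ici 0) := by
  intro hF
  obtain ⟨K, hK, hlip⟩ := exists_lipschitz_deriv_of_contDiffOn_two hF
  obtain ⟨m, hm⟩ := Q.exists_lt_q K
  obtain ⟨p, hp⟩ := Q.exists_deriv_orbit_eq m
  have hq := Q.q_pos m
  have hq7 := Q.seven_le_q m
  obtain ⟨⟨hs0, hs1⟩, hs2⟩ := hs
  have hA0 := Q.ripple_pos m
  have hA1 := Q.ripple_lt_one m
  have hε := Q.amp_pos m
  -- Half a period of the oscillation; the derivatives are compared at times `p` and `p + r`.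
  set r : ℝ := 1 / (2 * Q.q m) with hr
  have hr0 : 0 < r := by positivity
  have hr1 : r ≤ 1 := by
    rw [hr, div_le_one (by positivity)]; linarith
  set c := Real.cos (2 * Real.pi * Q.q m * s) with hc
  have m0 : (p : ℝ) + 0 ∈ Icc (p - 2 : ℝ) (p + 3) := ⟨by linarith, by linarith⟩
  have m1 : (p : ℝ) + s ∈ Icc (p - 2 : ℝ) (p + 3) := ⟨by linarith, by linarith⟩
  have m2 : (p : ℝ) + r ∈ Icc (p - 2 : ℝ) (p + 3) := ⟨by linarith, by linarith⟩
  have m3 : (p : ℝ) + (r + s) ∈ Icc (p - 2 : ℝ) (p + 3) := ⟨by linarith, by linarith⟩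
  have e0 : deriv Q.orbit (p + 0) = -Q.amp m ^ 2 * (1 + Q.ripple m) := by
    rw [(hp _ m0).2, Q.cos_two_pi_mul_int, mul_zero, Real.cos_zero, mul_one]
  have e1 : deriv Q.orbit (p + s) = -Q.amp m ^ 2 * (1 + Q.ripple m * c) := by
    rw [(hp _ m1).2, Q.cos_two_pi_mul_int]
  have hπ : 2 * Real.pi * Q.q m * r = Real.pi := by rw [hr]; field_simp
  have e2 : deriv Q.orbit (p + r) = -Q.amp m ^ 2 * (1 - Q.ripple m) := by
    rw [(hp _ m2).2, Q.cos_two_pi_mul_int, hπ, Real.cos_pi]; ring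
  have e3 : deriv Q.orbit (p + (r + s)) = -Q.amp m ^ 2 * (1 - Q.ripple m * c) := by
    rw [(hp _ m3).2, Q.cos_two_pi_mul_int, mul_add _ r s, hπ, add_comm Real.pi, Real.cos_add_pi]
    ring
  have h1 := hlip _ (hp _ m2).1 _ (hp _ m0).1
  have h2 := Q.abs_orbit_sub_le (fun t ht => (hp t ht).2) m0 m2
  rw [add_sub_add_left_eq_sub, sub_zero, abs_of_pos hr0] at h2
  rw [(Q.hasDerivAt_flow s _).deriv, (Q.hasDerivAt_flow s _).deriv, add_assoc, e3, e2, add_zero,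
    e1, ← add_zero (p : ℝ), e0, add_zero] at h1
  have h3 : -Q.amp m ^ 2 * (1 - Q.ripple m * c) * (-Q.amp m ^ 2 * (1 - Q.ripple m))⁻¹ -
      -Q.amp m ^ 2 * (1 + Q.ripple m * c) * (-Q.amp m ^ 2 * (1 + Q.ripple m))⁻¹ =
      2 * Q.ripple m * (1 - c) / (1 - Q.ripple m ^ 2) := by
    have a1 : 1 - Q.ripple m ≠ 0 := by linarith
    have a2 : 1 + Q.ripple m ≠ 0 := by linarith
    have a3 : 1 - Q.ripple m ^ 2 ≠ 0 := by
      rw [show 1 - Q.ripple m ^ 2 = (1 - Q.ripple m) * (1 + Q.ripple m) by ring]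
      exact mul_ne_zero a1 a2
    have := hε.ne'
    field_simp
    ring
  have hc1 : 0 ≤ 1 - c := by linarith [Real.cos_le_one (2 * Real.pi * Q.q m * s)]
  have h4 : 2 * Q.ripple m * (1 - c) ≤ 2 * Q.ripple m * (1 - c) / (1 - Q.ripple m ^ 2) := by
    rw [le_div_iff₀ (by nlinarith)]
    have : 0 ≤ 2 * Q.ripple m * (1 - c) := by positivity
    nlinarith [sq_nonneg (Q.ripple m)]
  have h5 : 2 * Q.ripple m * (2 * (Q.q m : ℝ)⁻¹ ^ 2) ≤ K * (Q.amp m ^ 2 * 2 * r) := by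
    calc _ ≤ 2 * Q.ripple m * (1 - c) := by
          gcongr
          exact hs2 m
      _ ≤ _ := h4
      _ ≤ K * |Q.orbit (p + r) - Q.orbit (p + 0)| := by
          rw [← h3, add_zero]; exact (le_abs_self _).trans h1
      _ ≤ _ := by gcongr
  have e5 : 2 * Q.ripple m * (2 * (Q.q m : ℝ)⁻¹ ^ 2) = Q.amp m * (Q.q m : ℝ)⁻¹ * (8 * Real.pi) := by
    rw [ripple]; field_simp; ring
  have e6 : K * (Q.amp m ^ 2 * 2 * r) = Q.amp m * (Q.q m : ℝ)⁻¹ * (K * Q.amp m) := by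
    rw [hr]; field_simp
  rw [e5, e6] at h5
  have h6 : 8 * Real.pi ≤ K * Q.amp m := le_of_mul_le_mul_left h5 (by positivity)
  have h7 : K * Q.amp m ≤ 1 := by
    calc K * Q.amp m ≤ Q.q m * (Q.q m : ℝ)⁻¹ ^ 3 := by
          gcongr
          exact Q.amp_le m
      _ = (Q.q m : ℝ)⁻¹ ^ 2 := by field_simp
      _ ≤ 1 := pow_le_one₀ (by positivity) (inv_le_one_of_one_le₀ (Q.one_le_q m))
  linarith [Real.pi_gt_three]

/-- In the `m`-th slow region the derivative of the field oscillates by `amp m * (2π q m) ^ 2` on an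
interval of length about `amp m ^ 2 / q m`. -/
theorem not_contDiffOn_field : ¬ ContDiffOn ℝ 2 Q.field (Ici 0) := by
  intro hF
  obtain ⟨K, hK, hlip⟩ := exists_lipschitz_deriv_of_contDiffOn_two hF
  obtain ⟨m, hm⟩ := Q.exists_lt_q K
  obtain ⟨p, hp⟩ := Q.exists_deriv_orbit_eq m
  have hq := Q.q_pos m
  have hq7 := Q.seven_le_q m
  have hA0 := Q.ripple_pos m
  have hε := Q.amp_pos m
  -- A quarter of a period: the second derivative of the orbit vanishes at time `p` and is extremal
  -- at time `p + r`.
  set r : ℝ := 1 / (4 * Q.q m) with hr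
  have hr0 : 0 < r := by positivity
  have hr1 : r ≤ 1 := by
    rw [hr, div_le_one (by positivity)]; linarith
  have m0 : (p : ℝ) ∈ Ioo (p - 2 : ℝ) (p + 3) := ⟨by linarith, by linarith⟩
  have m2 : (p : ℝ) + r ∈ Ioo (p - 2 : ℝ) (p + 3) := ⟨by linarith, by linarith⟩
  have hd : ∀ t ∈ Ioo (p - 2 : ℝ) (p + 3), deriv (deriv Q.orbit) t =
      Q.amp m ^ 2 * Q.ripple m * (2 * Real.pi * Q.q m) * Real.sin (2 * Real.pi * Q.q m * t) := by
    intro t ht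
    have h1 : deriv Q.orbit =ᶠ[𝓝 t] fun t =>
        -Q.amp m ^ 2 * (1 + Q.ripple m * Real.cos (2 * Real.pi * Q.q m * t)) := by
      filter_upwards [Ioo_mem_nhds ht.1 ht.2] with u hu using (hp u (Ioo_subset_Icc_self hu)).2
    have h2 := (((((hasDerivAt_id t).const_mul (2 * Real.pi * Q.q m)).cos).const_mul
      (Q.ripple m)).const_add 1).const_mul (-Q.amp m ^ 2)
    rw [h1.deriv_eq]
    refine h2.deriv.trans ?_
    simp only [id]
    ring
  have hsin : Real.sin (2 * Real.pi * Q.q m * p) = 0 := by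
    rw [show 2 * Real.pi * Q.q m * p = ((2 * Q.q m * p : ℤ) : ℝ) * Real.pi by push_cast; ring]
    exact Real.sin_int_mul_pi _
  have hπ : 2 * Real.pi * Q.q m * r = Real.pi / 2 := by rw [hr]; field_simp; norm_num
  have hsin2 : Real.sin (2 * Real.pi * Q.q m * (p + r)) = 1 := by
    rw [mul_add, hπ, Real.sin_add_pi_div_two]
    simpa using Q.cos_two_pi_mul_int m p 0
  have hcos2 : Real.cos (2 * Real.pi * Q.q m * (p + r)) = 0 := by
    rw [Q.cos_two_pi_mul_int, hπ, Real.cos_pi_div_two]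
  have h1 := hlip _ (hp _ (Ioo_subset_Icc_self m2)).1 _ (hp _ (Ioo_subset_Icc_self m0)).1
  have h2 := Q.abs_orbit_sub_le (fun t ht => (hp t ht).2) (Ioo_subset_Icc_self m0)
    (Ioo_subset_Icc_self m2)
  rw [add_sub_cancel_left, abs_of_pos hr0] at h2
  rw [(Q.hasDerivAt_field (Q.orbit_pos _)).deriv, (Q.hasDerivAt_field (Q.orbit_pos _)).deriv,
    ← Q.deriv_orbit, ← Q.deriv_orbit, Q.clock_orbit, Q.clock_orbit, hd _ m0, hd _ m2, hsin, hsin2,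
    (hp _ (Ioo_subset_Icc_self m2)).2, hcos2] at h1
  have h3 : |Q.amp m ^ 2 * Q.ripple m * (2 * Real.pi * Q.q m) * 1 *
      (-Q.amp m ^ 2 * (1 + Q.ripple m * 0))⁻¹ - Q.amp m ^ 2 * Q.ripple m * (2 * Real.pi * Q.q m) *
      0 * (deriv Q.orbit p)⁻¹| = Q.ripple m * (2 * Real.pi * Q.q m) := by
    rw [← abs_of_pos (show 0 < Q.ripple m * (2 * Real.pi * Q.q m) by positivity), ← abs_neg]
    congr 1
    have := hε.ne'
    field_simp
    ring
  rw [h3] at h1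
  have h5 : Q.ripple m * (2 * Real.pi * Q.q m) ≤ K * (Q.amp m ^ 2 * 2 * r) :=
    h1.trans (by gcongr)
  have e5 : Q.ripple m * (2 * Real.pi * Q.q m) = Q.amp m * ((2 * Real.pi * Q.q m) ^ 2) := by
    rw [ripple]; ring
  have e6 : K * (Q.amp m ^ 2 * 2 * r) = Q.amp m * (K * (Q.amp m * (2 * r))) := by ring
  rw [e5, e6] at h5
  have h6 := le_of_mul_le_mul_left h5 hε
  have h7 : K * (Q.amp m * (2 * r)) ≤ K * (1 * (2 * 1)) := by
    have := Q.amp_le_one m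
    gcongr
  have h8 : (1 * Q.q m : ℝ) ^ 2 ≤ (2 * Real.pi * Q.q m) ^ 2 := by
    gcongr
    linarith [Real.pi_gt_three]
  nlinarith

end Frequencies

/-! ### Frequencies adapted to non-diophantine numbers -/

theorem exists_lt_distInt {a : ℝ} (ha : Irrational a) (R : ℕ) :
    ∃ C : ℝ, 0 < C ∧ C ≤ 1 ∧ ∀ q : ℕ, 0 < q → q < R → C < distInt (q * a) := by
  induction R with
  | zero => exact ⟨1, one_pos, le_rfl, fun q _ h => absurd h (Nat.not_lt_zero q)⟩
  | succ R ih =>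
    obtain ⟨C, hC, hC1, h⟩ := ih
    rcases Nat.eq_zero_or_pos R with rfl | hR
    · exact ⟨C, hC, hC1, fun q h0 h1 => by omega⟩
    have hd : 0 < distInt (R * a) := by
      refine abs_pos.2 fun h0 => ?_
      exact (ha.natCast_mul hR.ne').ne_int _ (sub_eq_zero.1 h0)
    refine ⟨min C (distInt (R * a) / 2), lt_min hC (half_pos hd), (min_le_left _ _).trans hC1,
      fun q h0 h1 => ?_⟩
    rcases (Nat.lt_succ_iff.1 h1).eq_or_lt with rfl | h2
    · exact (min_le_right _ _).trans_lt (half_lt_self hd)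
    · exact (min_le_left _ _).trans_lt (h q h0 h2)

/-- The failing lower bounds are violated by arbitrarily large `q`, because small `q` are kept
away from `0` by irrationality. -/
theorem exists_distInt_le {d : ℕ} (hd : 1 ≤ d) {α : Fin d → ℝ} (hirr : ∀ i, Irrational (α i))
    (hα : ¬ SimultaneouslyDiophantine α) (L R : ℕ) :
    ∃ q : ℕ, R ≤ q ∧ ∀ i, distInt (q * α i) ≤ (q : ℝ)⁻¹ ^ L := by
  obtain ⟨C, hC, hC1, hlow⟩ := exists_lt_distInt (hirr ⟨0, hd⟩) R
  have hex : ∃ q : ℕ, 0 < q ∧ ⨆ i, distInt ((q : ℝ) * α i) ≤ C / (q : ℝ) ^ (1 + (L + 1 : ℝ)) := by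
    by_contra! h
    exact hα ⟨L + 1, by positivity, C, hC, h⟩
  obtain ⟨q, hq, h⟩ := hex
  have hq1 : (1 : ℝ) ≤ q := by exact_mod_cast hq
  have hle : ∀ i, distInt (q * α i) ≤ C / (q : ℝ) ^ (1 + (L + 1 : ℝ)) := fun i =>
    (le_ciSup (f := fun i => distInt ((q : ℝ) * α i)) (Set.finite_range _).bddAbove i).trans h
  refine ⟨q, ?_, fun i => (hle i).trans ?_⟩
  · by_contra! hlt
    refine absurd ((hlow q hq hlt).trans_le (hle ⟨0, hd⟩)) (not_lt.2 ?_)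
    exact div_le_self hC.le (Real.one_le_rpow hq1 (by positivity))
  · rw [inv_pow, ← one_div]
    gcongr
    rw [← Real.rpow_natCast]
    exact Real.rpow_le_rpow_of_exponent_le hq1 (by linarith)

/-- Frequencies along which all `α i` are approximated by fractions to superlinearly growing order;
they are chosen one after the other. -/
theorem exists_frequencies {d : ℕ} (hd : 1 ≤ d) {α : Fin d → ℝ} (hirr : ∀ i, Irrational (α i))
    (hα : ¬ SimultaneouslyDiophantine α) : ∃ Q : Frequencies, ∀ m i,
    distInt (Q.q m * α i) ≤ (Q.q m : ℝ)⁻¹ ^ ((2 * m + 8) ^ 2) := by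
  choose g hgR hg using exists_distInt_le hd hirr hα
  obtain ⟨S, hS⟩ : ∃ S, ∀ y, |deriv window y| ≤ S := by
    obtain ⟨S, -, hS⟩ := exists_abs_iteratedDeriv_le_of_support contDiff_window
      (fun y hy => window_eq_zero fun h => hy (Ioo_subset_Icc_self h)) 1
    exact ⟨S, fun y => by simpa using hS 1 le_rfl y⟩
  set B : ℕ → ℕ := fun m => ⌈Real.exp (m + 10)⌉₊ + ⌈S⌉₊ + 7 with hB
  set q : ℕ → ℕ := fun m => Nat.rec (g ((2 * 0 + 8) ^ 2) (B 0))
    (fun m p => g ((2 * (m + 1) + 8) ^ 2) (p ^ 16 + B (m + 1))) m with hq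
  have hqB : ∀ m, B m ≤ q m := fun m => by
    cases m with
    | zero => exact hgR _ _
    | succ m => exact (Nat.le_add_left _ _).trans (hgR _ _)
  have hqB' : ∀ m : ℕ, (⌈Real.exp (m + 10)⌉₊ : ℝ) + ⌈S⌉₊ + 7 ≤ q m := fun m => by
    have : ((B m : ℕ) : ℝ) ≤ q m := Nat.cast_le.2 (hqB m)
    simpa [hB] using this
  refine ⟨⟨q, fun m => ?_, fun m => (Nat.le_add_right _ _).trans (hgR _ _), fun m y => ?_⟩, ?_⟩
  · have := hqB' m
    have := Nat.le_ceil (Real.exp (m + 10))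
    have : (0 : ℝ) ≤ ⌈S⌉₊ := Nat.cast_nonneg _
    linarith
  · have := hqB' m
    have := Nat.le_ceil S
    have := hS y
    have : (0 : ℝ) ≤ ⌈Real.exp (m + 10)⌉₊ := Nat.cast_nonneg _
    linarith
  · intro m i
    cases m with
    | zero => exact hg _ _ i
    | succ m => exact hg _ _ i

namespace Frequencies

variable (Q : Frequencies)

theorem resonant_of_distInt_le {d : ℕ} {α : Fin d → ℝ}
    (hQ : ∀ m i, distInt (Q.q m * α i) ≤ (Q.q m : ℝ)⁻¹ ^ ((2 * m + 8) ^ 2))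
    (k : ℤ) (n : Fin d → ℤ) : Q.Resonant (k + ∑ i, (n i : ℝ) * α i) := by
  refine ⟨∑ i, |(n i : ℝ)|, Finset.sum_nonneg fun i _ => abs_nonneg _, fun m =>
    ⟨Q.q m * k + ∑ i, n i * round ((Q.q m : ℝ) * α i), ?_⟩⟩
  have e : (Q.q m : ℝ) * (k + ∑ i, (n i : ℝ) * α i) -
      ((Q.q m * k + ∑ i, n i * round ((Q.q m : ℝ) * α i) : ℤ) : ℝ) =
      ∑ i, (n i : ℝ) * (Q.q m * α i - round ((Q.q m : ℝ) * α i)) := by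
    push_cast
    simp only [mul_sub, Finset.sum_sub_distrib, mul_add, Finset.mul_sum]
    rw [add_sub_add_left_eq_sub]
    congr 1
    exact Finset.sum_congr rfl fun i _ => by ring
  rw [e, Finset.sum_mul]
  refine (Finset.abs_sum_le_sum_abs _ _).trans (Finset.sum_le_sum fun i _ => ?_)
  rw [abs_mul]
  exact mul_le_mul_of_nonneg_left (hQ m i) (abs_nonneg _)

/-! ### A Cantor set of non-resonant times -/

/-- The times in `[0, 1]` within `q⁻² / 2` of a fraction of denominator `q = q m`. -/
def nearFractions (m : ℕ) : Set ℝ :=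
  ⋃ p ∈ Finset.range (Q.q m + 1), Metric.ball ((p : ℝ) / Q.q m) ((Q.q m : ℝ)⁻¹ ^ 2 / 2)

theorem volume_nearFractions_le (m : ℕ) :
    MeasureTheory.volume (Q.nearFractions m) ≤ ENNReal.ofReal (1 / 8 * (1 / 2) ^ m) := by
  have hq := Q.q_pos m
  refine (MeasureTheory.measure_biUnion_finset_le _ _).trans ?_
  simp only [Real.volume_ball, Finset.sum_const, Finset.card_range, nsmul_eq_mul]
  rw [← ENNReal.ofReal_natCast, ← ENNReal.ofReal_mul (Nat.cast_nonneg _)]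
  refine ENNReal.ofReal_le_ofReal ?_
  have h1 : (16 : ℝ) * 2 ^ m ≤ Q.q m := by
    refine le_trans ?_ (Q.exp_le m)
    have h2 : (2 : ℝ) ≤ Real.exp 1 := by linarith [Real.add_one_le_exp (1 : ℝ)]
    calc (16 : ℝ) * 2 ^ m = 2 ^ (m + 4) := by ring
      _ ≤ Real.exp 1 ^ (m + 4) := by gcongr
      _ = Real.exp (m + 4) := by rw [← Real.exp_nat_mul]; push_cast; ring_nf
      _ ≤ _ := Real.exp_le_exp.2 (by linarith)
  have h3 := Q.one_le_q m
  calc ((Q.q m + 1 : ℕ) : ℝ) * (2 * ((Q.q m : ℝ)⁻¹ ^ 2 / 2)) ≤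
        (2 * Q.q m) * (2 * ((Q.q m : ℝ)⁻¹ ^ 2 / 2)) := by
        gcongr
        push_cast
        linarith
    _ = 2 * (Q.q m : ℝ)⁻¹ := by field_simp
    _ ≤ 2 * (16 * 2 ^ m : ℝ)⁻¹ := by gcongr
    _ = _ := by rw [one_div_pow]; field_simp; norm_num

/-- The intervals to be avoided have total length at most `1 / 4`. -/
theorem not_countable_compl_nearFractions :
    ¬ (Icc (0 : ℝ) 1 \ ⋃ m, Q.nearFractions m).Countable := by
  intro hc
  have h0 := hc.measure_zero MeasureTheory.volume
  have hs : Summable fun m : ℕ => (1 / 8 : ℝ) * (1 / 2) ^ m := summable_geometric_two.mul_left _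
  have h1 : MeasureTheory.volume (⋃ m, Q.nearFractions m) ≤ ENNReal.ofReal (1 / 4) := by
    refine (MeasureTheory.measure_iUnion_le _).trans
      ((ENNReal.tsum_le_tsum Q.volume_nearFractions_le).trans ?_)
    rw [← ENNReal.ofReal_tsum_of_nonneg (fun m => by positivity) hs, tsum_mul_left,
      tsum_geometric_two]
    norm_num
  have h2 : MeasureTheory.volume (Icc (0 : ℝ) 1) ≤
      MeasureTheory.volume (Icc (0 : ℝ) 1 \ ⋃ m, Q.nearFractions m) +
        MeasureTheory.volume (⋃ m, Q.nearFractions m) :=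
    (MeasureTheory.measure_mono (subset_sdiff_union _ _)).trans (MeasureTheory.measure_union_le _ _)
  rw [h0, zero_add, Real.volume_Icc] at h2
  have h3 := h2.trans h1
  rw [ENNReal.ofReal_le_ofReal_iff (by norm_num)] at h3
  norm_num at h3

theorem nonResonant_of_not_mem {s : ℝ} (hs : s ∈ Icc (0 : ℝ) 1 \ ⋃ m, Q.nearFractions m) :
    Q.NonResonant s := by
  refine ⟨hs.1, fun m => ?_⟩
  obtain ⟨⟨h0, h1⟩, h2⟩ := hs
  have hq := Q.q_pos m
  set x : ℝ := Q.q m * s with hx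
  have hp0 : 0 ≤ round x := by
    rw [round_eq]; exact Int.floor_nonneg.2 (by positivity)
  have hp1 : round x ≤ Q.q m := by
    rw [round_eq, ← Int.lt_add_one_iff, Int.floor_lt]
    push_cast
    nlinarith
  obtain ⟨p, hp⟩ := Int.eq_ofNat_of_zero_le hp0
  have hy := abs_sub_round x
  set y := x - round x with hydef
  have hfar : (Q.q m : ℝ)⁻¹ ^ 2 / 2 ≤ |s - p / Q.q m| := by
    by_contra! hlt
    refine h2 (mem_iUnion.2 ⟨m, mem_iUnion₂.2 ⟨p, Finset.mem_range.2 (by omega), ?_⟩⟩)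
    rwa [Metric.mem_ball, Real.dist_eq]
  have hy2 : (Q.q m : ℝ)⁻¹ / 2 ≤ |y| := by
    have e : y = Q.q m * (s - p / Q.q m) := by
      rw [hydef, hp, hx]; push_cast; field_simp
    rw [e, abs_mul, abs_of_pos hq]
    calc (Q.q m : ℝ)⁻¹ / 2 = Q.q m * ((Q.q m : ℝ)⁻¹ ^ 2 / 2) := by field_simp
      _ ≤ _ := by gcongr
  have ecos : Real.cos (2 * Real.pi * Q.q m * s) = Real.cos (2 * Real.pi * y) := by
    rw [← Real.cos_sub_int_mul_two_pi _ (round x)]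
    congr 1
    rw [hydef, hx]
    ring
  have hπ := Real.pi_pos
  have hcos := Real.cos_le_one_sub_mul_cos_sq (x := 2 * Real.pi * y) (by
    rw [abs_mul, abs_of_pos Real.two_pi_pos]; nlinarith)
  rw [ecos]
  have e8 : 2 / Real.pi ^ 2 * (2 * Real.pi * y) ^ 2 = 8 * y ^ 2 := by field_simp; ring
  have hsq : ((Q.q m : ℝ)⁻¹ / 2) ^ 2 ≤ y ^ 2 := by
    rw [← sq_abs y]; gcongr
  rw [e8] at hcos
  nlinarith

end Frequencies

theorem exists_isCantorSet_of_isClosed {S : Set ℝ} (hS : IsClosed S) (hc : ¬ S.Countable) :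
    ∃ H ⊆ S, IsCantorSet H := by
  obtain ⟨f, hfS, hf, hinj⟩ := hS.exists_nat_bool_injection_of_not_countable hc
  exact ⟨range f, hfS,
    ⟨(hf.isClosedEmbedding hinj).isEmbedding.toHomeomorph.symm⟩⟩

theorem Frequencies.exists_isCantorSet_nonResonant (Q : Frequencies) :
    ∃ H : Set ℝ, IsCantorSet H ∧ ∀ s ∈ H, Q.NonResonant s := by
  obtain ⟨H, hH, hC⟩ := exists_isCantorSet_of_isClosed
    (isClosed_Icc.sdiff (isOpen_iUnion fun m => isOpen_biUnion fun p _ => Metric.isOpen_ball))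
    Q.not_countable_compl_nearFractions
  exact ⟨H, hC, fun s hs => Q.nonResonant_of_not_mem (hH hs)⟩

theorem theoremt (d : ℕ) (hd : 1 ≤ d) (α : Fin d → ℝ) (hirr : ∀ i, Irrational (α i))
    (hα : ¬ SimultaneouslyDiophantine α) :
    ∃ (ξ : ℝ → ℝ) (f : ℝ → ℝ → ℝ),
      ContDiffOn ℝ 1 ξ (Ici 0) ∧
      IsContracting ξ ∧
      IsCompleteFlow ξ f ∧
      (∀ (m : ℤ) (n : Fin d → ℤ),
        ContDiffOn ℝ ∞ (f ((m : ℝ) + ∑ i, (n i : ℝ) * α i)) (Ici 0)) ∧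
      (∃ H : Set ℝ, IsCantorSet H ∧ ∀ t ∈ H, ¬ ContDiffOn ℝ 2 (f t) (Ici 0)) ∧
      ¬ ContDiffOn ℝ 2 ξ (Ici 0) := by
  obtain ⟨Q, hQ⟩ := exists_frequencies hd hirr hα
  obtain ⟨H, hH, hHs⟩ := Q.exists_isCantorSet_nonResonant
  exact ⟨Q.field, Q.flow, Q.contDiff_one_field.contDiffOn, Q.isContracting_field,
    Q.isCompleteFlow_flow,
    fun m n => (Q.contDiff_flow (Q.resonant_of_distInt_le hQ m n)).contDiffOn,
    ⟨H, hH, fun t ht => Q.not_contDiffOn_flow (hHs t ht)⟩, Q.not_contDiffOn_field⟩
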